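/- For an infinite cardinal $\mu$ and a cardinal $\kappa>0$, equip the set ${}^{\mu}\kappa$ of all functions from $\mu$ to $\kappa$ with the topology whose basic open sets are the sets $\{f\in{}^{\mu}\kappa : s\subseteq f\}$ with $s:\xi\to\kappa$ and $\xi<\mu$. For an infinite cardinal $\nu$, equip the power set $\mathcal{P}(\nu)$ with the topology whose basic open sets are the sets $\{y\subseteq\nu : y\cap\eta=a\}$ with $\eta<\nu$ and $a\subseteq\eta$. An injection $\iota:{}^{\mu}\kappa\to\mathcal{P}(\nu)$ is a perfect embedding if it is a homeomorphism between ${}^{\mu}\kappa$ and the subspace $\mathrm{ran}(\iota)$ of $\mathcal{P}(\nu)$. A measurable cardinal is an uncountable cardinal $\delta$ that carries a $\delta$-complete nonprincipal ultrafilter, and $H(\kappa)$ is the collection of all sets whose transitive closure has cardinality less than $\kappa$. A $\Sigma_1$-formula is a formula of the language of set theory that consists of a finite block of existential quantifiers followed by a formula all of whose quantifiers are bounded. Theorem. Let $\kappa$ be a limit of measurable cardinals (that is, $\kappa>0$ and the measurable cardinals smaller than $\kappa$ are unbounded in $\kappa$), and let $D\subseteq\mathcal{P}(\kappa)$ be definable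 by a $\Sigma_1$-formula with parameters in $H(\kappa)\cup\{\kappa\}$, i.e. there are a $\Sigma_1$-formula $\varphi(v_0,\dots,v_n)$ and $p_1,\dots,p_n\in H(\kappa)\cup\{\kappa\}$ with $D=\{y : \varphi(y,p_1,\dots,p_n)\}$. If $|D|>\kappa$, then there is a perfect embedding $\iota:{}^{\mathrm{cof}(\kappa)}\kappa\to\mathcal{P}(\kappa)$ with $\mathrm{ran}(\iota)\subseteq D$. -/

import Mathlib

open Set Cardinal

universe u

namespace PerfectSubset

/-! ### The language of set theory and the Lévy hierarchy at its lowest levels -/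

/-- The only relation symbol of the language of set theory: a binary one. -/
inductive MemRel : ℕ → Type
  | mem : MemRel 2

/-- The first-order language of set theory. -/
def langSet : FirstOrder.Language := ⟨fun _ => Empty, MemRel⟩

/-- The membership symbol. -/
def memSymb : langSet.Relations 2 := MemRel.mem

/-- The universe of sets as a structure, the relation symbol being interpreted by membership. -/
instance structureZFSet : langSet.Structure ZFSet.{u} where
  funMap := fun f => f.elim
  RelMap := fun {_} r => match r with
    | MemRel.mem => fun v => v 0 ∈ v 1

open FirstOrder Language BoundedFormula

/-- The atomic formula `t ∈ s`. -/
def memFormula {α : Type} {n : ℕ} (t s : langSet.Term (α ⊕ Fin n)) :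
    langSet.BoundedFormula α n :=
  memSymb.boundedFormula₂ t s

/-- The variable `v` of a formula with `n` de Bruijn variables, below one more quantifier. -/
def liftVar {α : Type} {n : ℕ} (v : α ⊕ Fin n) : langSet.Term (α ⊕ Fin (n + 1)) :=
  Term.var (Sum.map id Fin.castSucc v)

/-- The variable bound by the innermost of `n + 1` quantifiers. -/
def lastVar {α : Type} {n : ℕ} : langSet.Term (α ⊕ Fin (n + 1)) :=
  Term.var (Sum.inr (Fin.last n))

/-- The `Δ₀` formulas: all quantifiers are bounded, that is, of the form `∀ x ∈ v` or `∃ x ∈ v`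
with a variable `v` different from `x`. Negation, conjunction and disjunction are
abbreviations in terms of `⊥` and implication. -/
inductive IsDelta0 {α : Type} : ∀ {n : ℕ}, langSet.BoundedFormula α n → Prop
  | falsum {n : ℕ} : IsDelta0 (BoundedFormula.falsum : langSet.BoundedFormula α n)
  | equal {n : ℕ} (t s : langSet.Term (α ⊕ Fin n)) : IsDelta0 (BoundedFormula.equal t s)
  | mem {n : ℕ} (t s : langSet.Term (α ⊕ Fin n)) : IsDelta0 (memFormula t s)
  | imp {n : ℕ} {φ ψ : langSet.BoundedFormula α n} :
      IsDelta0 φ → IsDelta0 ψ → IsDelta0 (φ.imp ψ)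
  | ball {n : ℕ} (v : α ⊕ Fin n) {φ : langSet.BoundedFormula α (n + 1)} :
      IsDelta0 φ → IsDelta0 (BoundedFormula.all ((memFormula lastVar (liftVar v)).imp φ))
  | bex {n : ℕ} (v : α ⊕ Fin n) {φ : langSet.BoundedFormula α (n + 1)} :
      IsDelta0 φ → IsDelta0 (BoundedFormula.ex (memFormula lastVar (liftVar v) ⊓ φ))

/-- The `Σ₁` formulas: a finite block of existential quantifiers before a `Δ₀` formula. -/
inductive IsSigma1 {α : Type} : ∀ {n : ℕ}, langSet.BoundedFormula α n → Prop
  | of_delta0 {n : ℕ} {φ : langSet.BoundedFormula α n} : IsDelta0 φ → IsSigma1 φ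
  | ex {n : ℕ} {φ : langSet.BoundedFormula α (n + 1)} :
      IsSigma1 φ → IsSigma1 (BoundedFormula.ex φ)

/-- `D` is definable (in the universe of sets) by a `Σ₁` formula with parameters in `P`. -/
def Sigma1DefinableWith (P : Set ZFSet.{u}) (D : ZFSet.{u}) : Prop :=
  ∃ (n : ℕ) (φ : langSet.Formula (Fin (n + 1))) (p : Fin n → ZFSet.{u}),
    IsSigma1 φ ∧ (∀ i, p i ∈ P) ∧
      ∀ y : ZFSet.{u}, y ∈ D ↔ φ.Realize (Fin.cons y p : Fin (n + 1) → ZFSet.{u})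

/-! ### Cardinals and hereditarily small sets -/

/-- The elements of the transitive closure of `x`. -/
def transClosure (x : ZFSet.{u}) : Set ZFSet.{u} :=
  {y | Relation.TransGen (· ∈ ·) y x}

/-- `H(κ)`: the sets whose transitive closure has cardinality less than `κ`. -/
def H (κ : Cardinal.{u}) : Set ZFSet.{u} :=
  {x | #(transClosure x) < lift.{u + 1} κ}

/-- `δ` is a measurable cardinal: it is uncountable and there is a `δ`-complete nonprincipal
ultrafilter on (a set of size) `δ`. -/
def IsMeasurableCardinal (δ : Cardinal.{u}) : Prop :=
  ℵ₀ < δ ∧ ∃ U : Ultrafilter δ.ord.ToType,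
    CardinalInterFilter (U : Filter δ.ord.ToType) δ ∧ ∀ a, {a} ∉ U

/-- `κ` is a limit of measurable cardinals. -/
def IsLimitOfMeasurables (κ : Cardinal.{u}) : Prop :=
  κ ≠ 0 ∧ ∀ ν < κ, ∃ δ, ν < δ ∧ δ < κ ∧ IsMeasurableCardinal δ

/-! ### Function spaces and power sets -/

/-- The set of all functions from the ordinal `μ` to the ordinal `κ`. -/
def FunSpace (μ κ : Ordinal.{u}) : Type (u + 1) :=
  Iio μ → Iio κ

/-- The set of all functions from `μ` to `κ` that extend `s : ξ → κ`. -/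
def FunSpace.cone {μ κ ξ : Ordinal.{u}} (hξ : ξ < μ) (s : Iio ξ → Iio κ) :
    Set (FunSpace μ κ) :=
  {f | ∀ i : Iio ξ, f ⟨i.1, lt_trans i.2 hξ⟩ = s i}

/-- The topology whose basic open sets consist of all extensions of a function `s : ξ → κ`
with `ξ < μ`. -/
instance FunSpace.topology (μ κ : Ordinal.{u}) : TopologicalSpace (FunSpace μ κ) :=
  TopologicalSpace.generateFrom
    {U | ∃ (ξ : Ordinal.{u}) (hξ : ξ < μ) (s : Iio ξ → Iio κ), U = FunSpace.cone hξ s}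

/-- The power set of the (von Neumann) ordinal `ν`. -/
def PowSpace (ν : Ordinal.{u}) : Type (u + 1) :=
  {y : ZFSet.{u} // y ⊆ ν.toZFSet}

/-- The topology whose basic open sets consist of all subsets of `ν` whose intersection with
a given ordinal `η < ν` is a given subset of `η`. -/
instance PowSpace.topology (ν : Ordinal.{u}) : TopologicalSpace (PowSpace ν) :=
  TopologicalSpace.generateFrom
    {U | ∃ η < ν, ∃ a ⊆ η.toZFSet, U = {y : PowSpace ν | y.1 ∩ η.toZFSet = a}}

/-- A perfect embedding: an injection that is a homeomorphism onto its range. -/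
def IsPerfectEmbedding {μ κ ν : Ordinal.{u}} (ι : FunSpace μ κ → PowSpace ν) : Prop :=
  Topology.IsEmbedding ι

end PerfectSubset

/-!
Finite-support iterated ultrapowers by measures on cardinals below `κ` have transitive collapses
with embeddings `emb`, which preserve `Δ₀`-formulas by Łoś's theorem and hence `Σ₁`-formulas
upwards. If the measures are complete enough to fix the parameters and the iteration fixes `κ`, then
the image of every element of `D` lies in `D`.

Fix a measure on each of cofinally many measurable cardinals below `κ`. A set `y ⊆ κ` that no
iteration of the measure on `δ` moves is determined by `y ∩ δ`. Since `|D| > κ` and `κ` is a strong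
limit, some `y ∈ D` is therefore moved by an iteration of each of these measures. This gives, for
each measure, many iteration lengths for which the images of `y` differ from one another below `κ`.
Choose a cofinal sequence of the measures, of length `cof κ`, and send `f` to the image of `y` under
the iteration that uses the `ξ`-th measure with a length that codes `f ↾ ξ`. This is the perfect
embedding: an initial segment of the image depends on the first few measures only, because the later
ones are too complete to affect it, and it determines the corresponding part of `f`.
-/

namespace IteratedUltrapower

open Filter

/-! ### Finitary functions -/

section Finitary

variable {L X A B C : Type*}

/-- A function on `L → X` is finitary if it depends on finitely many coordinates only. Finitary
functions represent the elements of an iterated ultrapower with finite supports. -/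
def Finitary (F : (L → X) → A) : Prop := ∃ s : Finset L, DependsOn F (s : Set L)

namespace Finitary

theorem const (a : A) : Finitary fun _ : L → X => a := ⟨∅, fun _ _ _ => rfl⟩

theorem apply (i : L) : Finitary fun x : L → X => x i :=
  ⟨{i}, fun _ _ h => h i (by simp)⟩

theorem comp {F : (L → X) → A} (hF : Finitary F) (g : A → B) : Finitary fun x => g (F x) := by
  obtain ⟨s, hs⟩ := hF
  exact ⟨s, fun x y h => congrArg g (hs h)⟩

theorem prodMk {F : (L → X) → A} {G : (L → X) → B} (hF : Finitary F) (hG : Finitary G) :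
    Finitary fun x => (F x, G x) := by
  classical
  obtain ⟨s, hs⟩ := hF
  obtain ⟨t, ht⟩ := hG
  exact ⟨s ∪ t, fun x y h => Prod.ext (hs fun i hi => h i (by simp_all))
    (ht fun i hi => h i (by simp_all))⟩

theorem comp₂ {F : (L → X) → A} {G : (L → X) → B} (hF : Finitary F) (hG : Finitary G)
    (g : A → B → C) : Finitary fun x => g (F x) (G x) :=
  (hF.prodMk hG).comp fun p => g p.1 p.2

theorem pi {ι : Type*} [Finite ι] {A : ι → Type*} {F : ∀ k, (L → X) → A k}
    (hF : ∀ k, Finitary (F k)) : Finitary fun x k => F k x := by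
  classical
  choose s hs using hF
  have := Fintype.ofFinite ι
  refine ⟨Finset.univ.biUnion s, fun x y h => funext fun k => hs k fun i hi => h i ?_⟩
  simp only [Finset.coe_biUnion, Set.mem_iUnion]
  exact ⟨k, by simp, hi⟩

theorem comp_right {L' : Type*} {F : (L → X) → A} (hF : Finitary F) (e : L → L') :
    Finitary fun x : L' → X => F (x ∘ e) := by
  classical
  obtain ⟨s, hs⟩ := hF
  refine ⟨s.image e, fun x y h => hs fun i hi => h _ ?_⟩
  simp only [Finset.coe_image]
  exact mem_image_of_mem e hi

end Finitary

theorem dependsOn_comp_update [DecidableEq L] {F : (L → X) → A} {a : L} {s : Set L}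
    (hF : DependsOn F (insert a s)) : DependsOn (fun x z => F (Function.update x a z)) s := by
  refine fun x y h => funext fun z => hF fun i hi => ?_
  rcases eq_or_ne i a with rfl | hne
  · simp
  · simp [Function.update_of_ne hne, h i (hi.resolve_left hne)]

theorem exists_eq_comp_right_of_dependsOn [Nonempty X] {L' : Type*} {e : L' → L}
    (he : Function.Injective e) {F : (L → X) → A} {s : Finset L} (hF : DependsOn F (s : Set L))
    (hs : (s : Set L) ⊆ range e) :
    ∃ F' : (L' → X) → A, Finitary F' ∧ ∀ x, F x = F' (x ∘ e) := by
  let d : L → X := fun _ => Classical.arbitrary X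
  refine ⟨fun x => F (Function.extend e x d), ⟨s.preimage e he.injOn, fun x y h =>
    hF fun i hi => ?_⟩, fun x => hF fun i hi => ?_⟩ <;> obtain ⟨k, rfl⟩ := hs hi
  · rw [he.extend_apply, he.extend_apply]
    exact h k (by simpa using hi)
  · rw [he.extend_apply, Function.comp_apply]

end Finitary

/-! ### The filter of a finite support iteration -/

/-- The `σ`-complete ultrafilters on `X`. -/
abbrev SigmaUltrafilter (X : Type u) : Type u :=
  {U : Ultrafilter X // CountableInterFilter (U : Filter X)}

section IterFilter

variable {L X : Type u} [LinearOrder L] (U : L → SigmaUltrafilter X)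

/-- A strategy in the game in which the play `x : L → X` is built up coordinate by coordinate: it
assigns to every stage `i` and every play before `i` a set of allowed values that is large for the
ultrafilter of that stage. That `allowed i x` depends on the play before `i` only is expressed
by `dependsOn`. -/
structure Strategy where
  allowed : L → (L → X) → Set X
  allowed_mem : ∀ i x, allowed i x ∈ (U i).1
  dependsOn : ∀ i, DependsOn (allowed i) (Iio i)

variable {U}

/-- The plays that follow a strategy. -/
def Strategy.runs (S : Strategy U) : Set (L → X) := {x | ∀ i, x i ∈ S.allowed i x}

theorem Strategy.runs_nonempty [WellFoundedLT L] [Nonempty X] (S : Strategy U) :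
    S.runs.Nonempty := by
  classical
  have hne : ∀ i x, (S.allowed i x).Nonempty := fun i x =>
    (U i).1.nonempty_of_mem (S.allowed_mem i x)
  let ext (i : L) (f : ∀ k, k < i → X) : L → X := fun k =>
    if h : k < i then f k h else Classical.arbitrary X
  let step (i : L) (f : ∀ k, k < i → X) : X := (hne i (ext i f)).some
  let x : L → X := (wellFounded_lt (α := L)).fix step
  refine ⟨x, fun i => ?_⟩
  have hx : x i = step i fun k _ => x k := WellFounded.fix_eq _ _ _
  have hext : S.allowed i x = S.allowed i (ext i fun k _ => x k) :=
    S.dependsOn i fun k hk => by simp only [ext, dif_pos (mem_Iio.1 hk)]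
  rw [hx, hext]
  exact (hne i _).some_mem

variable (U)

/-- The filter on `L → X` that is generated by the runs of strategies: it iterates the ultrafilters
`U i` with finite supports along `L`. On finitary properties it decides like an ultrafilter. -/
def iterFilter : Filter (L → X) where
  sets := {P | ∃ S : Strategy U, S.runs ⊆ P}
  univ_sets := ⟨⟨fun _ _ => univ, fun _ _ => univ_mem, fun _ _ _ _ => rfl⟩, subset_univ _⟩
  sets_of_superset := fun ⟨S, hS⟩ h => ⟨S, hS.trans h⟩
  inter_sets := by
    rintro P Q ⟨S, hS⟩ ⟨T, hT⟩
    refine ⟨⟨fun i x => S.allowed i x ∩ T.allowed i x,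
      fun i x => inter_mem (S.allowed_mem i x) (T.allowed_mem i x),
      fun i x y h => congrArg₂ _ (S.dependsOn i h) (T.dependsOn i h)⟩, fun x hx => ?_⟩
    exact ⟨hS fun i => (hx i).1, hT fun i => (hx i).2⟩

variable {U}

theorem mem_iterFilter {P : Set (L → X)} :
    P ∈ iterFilter U ↔ ∃ S : Strategy U, S.runs ⊆ P := Iff.rfl

instance iterFilter_neBot [WellFoundedLT L] [Nonempty X] : (iterFilter U).NeBot := by
  refine ⟨fun h => ?_⟩
  obtain ⟨S, hS⟩ := mem_iterFilter.1 (h ▸ mem_bot : (∅ : Set (L → X)) ∈ iterFilter U)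
  obtain ⟨x, hx⟩ := S.runs_nonempty
  exact hS hx

theorem cardinalInterFilter_iterFilter {c : Cardinal.{u}}
    (h : ∀ i, CardinalInterFilter ((U i).1 : Filter X) c) :
    CardinalInterFilter (iterFilter U) c := by
  refine ⟨fun 𝒮 h𝒮 hmem => ?_⟩
  choose S hS using fun P : 𝒮 => mem_iterFilter.1 (hmem P.1 P.2)
  refine ⟨⟨fun i x => ⋂ P : 𝒮, (S P).allowed i x, fun i x => ?_, fun i x y hxy => ?_⟩,
    fun x hx P hP => hS ⟨P, hP⟩ fun i => mem_iInter.1 (hx i) ⟨P, hP⟩⟩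
  · have := h i
    exact (cardinal_iInter_mem h𝒮).2 fun P => (S P).allowed_mem i x
  · exact iInter_congr fun P => (S P).dependsOn i hxy

instance iterFilter_countableInter : CountableInterFilter (iterFilter U) :=
  have := cardinalInterFilter_iterFilter (c := ℵ₁) fun i =>
    cardinalInterFilter_aleph_one_iff.2 (U i).2
  CardinalInterFilter.toCountableInterFilter _ aleph0_lt_aleph_one

theorem eventually_of_eventually_update {P : (L → X) → Prop} {a : L} (hP : DependsOn P (Iic a))
    (h : ∀ᶠ x in iterFilter U, ∀ᶠ z in (U a).1, P (Function.update x a z)) :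
    ∀ᶠ x in iterFilter U, P x := by
  obtain ⟨S, hS⟩ := mem_iterFilter.1 h
  have hupdate : DependsOn (fun x z => P (Function.update x a z)) (Iio a) :=
    dependsOn_comp_update (by rwa [Iio_insert])
  -- At stage `a` also insist on a value that makes `P` true, if almost all values do.
  refine ⟨⟨fun i x => S.allowed i x ∩ {z | i = a →
    (∀ᶠ z in (U a).1, P (Function.update x a z)) → P (Function.update x a z)},
    fun i x => inter_mem (S.allowed_mem i x) ?_, fun i x y hxy => ?_⟩, fun x hx => ?_⟩
  · by_cases hi : i = a
    · subst hi
      by_cases hg : ∀ᶠ z in (U i).1, P (Function.update x i z)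
      · filter_upwards [hg] with z hz _ _ using hz
      · filter_upwards with z _ h' using absurd h' hg
    · filter_upwards with z h' using absurd h' hi
  · refine congrArg₂ _ (S.dependsOn i hxy) (ext fun z => forall_congr' fun hi => ?_)
    subst hi
    have hP' : ∀ z, P (Function.update x i z) = P (Function.update y i z) :=
      congrFun (hupdate hxy)
    simp only [hP']
  · simpa using (hx a).2 rfl (hS fun i => (hx i).1)

theorem Finitary.eventually_or_not {P : (L → X) → Prop} (hP : Finitary P) :
    (∀ᶠ x in iterFilter U, P x) ∨ ∀ᶠ x in iterFilter U, ¬ P x := by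
  classical
  obtain ⟨s, hs⟩ := hP
  induction s using Finset.induction_on_max generalizing P with
  | empty =>
    by_cases h : ∃ x, P x
    · obtain ⟨x, hx⟩ := h
      exact .inl (Eventually.of_forall fun y => (hs (x := x) (y := y) (by simp)).mp hx)
    · exact .inr (Eventually.of_forall fun y hy => h ⟨y, hy⟩)
  | insert a s has ih =>
    rw [Finset.coe_insert] at hs
    have hIic : insert a (s : Set L) ⊆ Iic a :=
      insert_subset le_rfl fun i hi => (has i hi).le
    have hdep : DependsOn (fun x => ∀ᶠ z in (U a).1, P (Function.update x a z)) (s : Set L) :=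
      fun x y hxy => congrArg (fun p => ∀ᶠ z in (U a).1, p z) (dependsOn_comp_update hs hxy)
    refine (ih hdep).imp (eventually_of_eventually_update (hs.mono hIic)) fun h => ?_
    refine eventually_of_eventually_update (P := fun x => ¬ P x)
      (fun x y hxy => congrArg Not (hs.mono hIic hxy)) ?_
    exact h.mono fun x hx => Ultrafilter.eventually_not.2 hx

theorem Finitary.eventually_not [WellFoundedLT L] [Nonempty X] {P : (L → X) → Prop}
    (hP : Finitary P) :
    (∀ᶠ x in iterFilter U, ¬ P x) ↔ ¬ ∀ᶠ x in iterFilter U, P x := by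
  refine ⟨fun h h' => ?_, fun h => hP.eventually_or_not.resolve_left h⟩
  obtain ⟨x, hx⟩ := (h.and h').exists
  exact hx.1 hx.2

theorem Finitary.eventually_imp {P Q : (L → X) → Prop} (hP : Finitary P) :
    (∀ᶠ x in iterFilter U, P x → Q x) ↔
      ((∀ᶠ x in iterFilter U, P x) → ∀ᶠ x in iterFilter U, Q x) := by
  refine ⟨fun h h' => h'.mp h, fun h => ?_⟩
  rcases hP.eventually_or_not (U := U) with h' | h'
  · exact (h h').mono fun _ hx _ => hx
  · exact h'.mono fun _ hx hx' => absurd hx' hx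

theorem eventually_update_iff [WellFoundedLT L] [Nonempty X] {P : (L → X) → Prop} {a : L}
    (hP : Finitary P) (hPa : DependsOn P (Iic a)) :
    (∀ᶠ x in iterFilter U, ∀ᶠ z in (U a).1, P (Function.update x a z)) ↔
      ∀ᶠ x in iterFilter U, P x := by
  refine ⟨eventually_of_eventually_update hPa, fun h => ?_⟩
  obtain ⟨s, hs⟩ := hP
  have hdep : Finitary fun x => ∀ᶠ z in (U a).1, P (Function.update x a z) :=
    ⟨s, fun x y hxy => congrArg (fun p => ∀ᶠ z in (U a).1, p z)
      (dependsOn_comp_update (hs.mono (subset_insert a _)) hxy)⟩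
  refine hdep.eventually_or_not.resolve_right fun h' => ?_
  have hnot : ∀ᶠ x in iterFilter U, ¬ P x :=
    eventually_of_eventually_update (fun x y hxy => congrArg Not (hPa hxy))
      (h'.mono fun x hx => Ultrafilter.eventually_not.2 hx)
  obtain ⟨x, hx, hx'⟩ := (h.and hnot).exists
  exact hx' hx

section Embedding

variable {L' : Type u} [LinearOrder L'] {U' : L' → SigmaUltrafilter X} {e : L → L'}

theorem tendsto_comp_right_iterFilter (he : StrictMono e) (hU : ∀ i, U' (e i) = U i) :
    Tendsto (fun x : L' → X => x ∘ e) (iterFilter U') (iterFilter U) := by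
  rintro P ⟨S, hS⟩
  refine ⟨⟨fun i x => {z | ∀ k, e k = i → z ∈ S.allowed k (x ∘ e)}, fun i x => ?_,
    fun i x y hxy => ?_⟩, fun x hx => hS fun k => hx (e k) k rfl⟩
  · by_cases h : ∃ k, e k = i
    · obtain ⟨k, rfl⟩ := h
      rw [hU]
      filter_upwards [S.allowed_mem k (x ∘ e)] with z hz k' hk'
      rwa [he.injective hk']
    · filter_upwards with z k hk using absurd ⟨k, hk⟩ h
  · ext z
    refine forall_congr' fun k => forall_congr' fun hk => ?_
    rw [S.dependsOn k fun k' hk' => show (x ∘ e) k' = (y ∘ e) k' from hxy _ (hk ▸ he hk')]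

theorem Finitary.eventually_comp_right_iff [WellFoundedLT L'] [Nonempty X] (he : StrictMono e)
    (hU : ∀ i, U' (e i) = U i) {P : (L → X) → Prop} (hP : Finitary P) :
    (∀ᶠ x in iterFilter U', P (x ∘ e)) ↔ ∀ᶠ x in iterFilter U, P x := by
  have ht := tendsto_comp_right_iterFilter he hU
  refine ⟨fun h => hP.eventually_or_not.resolve_right fun h' => ?_, fun h => ht.eventually h⟩
  obtain ⟨x, hx, hx'⟩ := (h.and (ht.eventually h')).exists
  exact hx' hx

end Embedding

end IterFilter

/-! ### Concatenation of index orders -/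

section Concat

variable {E Q N X : Type u} [LinearOrder E] [LinearOrder Q] [LinearOrder N]

/-- `N` is the concatenation of `E` and `Q`, up to the isomorphisms `e₁` and `e₂` with an initial
and a final segment. -/
structure IsConcat (e₁ : E → N) (e₂ : Q → N) : Prop where
  strictMono_left : StrictMono e₁
  strictMono_right : StrictMono e₂
  lt : ∀ a q, e₁ a < e₂ q
  cover : ∀ n, (∃ a, e₁ a = n) ∨ ∃ q, e₂ q = n

/-- The play on `N` that is put together from plays on its two segments. -/
noncomputable def join [Nonempty X] (e₁ : E → N) (e₂ : Q → N) (x : E → X) (z : Q → X) : N → X :=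
  Function.extend e₁ x (Function.extend e₂ z fun _ => Classical.arbitrary X)

variable [Nonempty X] {e₁ : E → N} {e₂ : Q → N}

theorem join_left (hc : IsConcat e₁ e₂) (x : E → X) (z : Q → X) (a : E) :
    join e₁ e₂ x z (e₁ a) = x a :=
  hc.strictMono_left.injective.extend_apply _ _ _

theorem join_right (hc : IsConcat e₁ e₂) (x : E → X) (z : Q → X) (q : Q) :
    join e₁ e₂ x z (e₂ q) = z q := by
  rw [join, Function.extend_apply', hc.strictMono_right.injective.extend_apply]
  rintro ⟨a, ha⟩
  exact (hc.lt a q).ne ha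

theorem eventually_join (hc : IsConcat e₁ e₂) {U : N → SigmaUltrafilter X} {P : (N → X) → Prop}
    (hP : ∀ᶠ w in iterFilter U, P w) :
    ∀ᶠ x in iterFilter fun a => U (e₁ a), ∀ᶠ z in iterFilter fun q => U (e₂ q),
      P (join e₁ e₂ x z) := by
  obtain ⟨S, hS⟩ := hP
  have hleft : ∀ (a : E) (x y : E → X) (z z' : Q → X), (∀ k < a, x k = y k) →
      S.allowed (e₁ a) (join e₁ e₂ x z) = S.allowed (e₁ a) (join e₁ e₂ y z') := by
    refine fun a x y z z' hxy => S.dependsOn _ fun k hk => ?_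
    rcases hc.cover k with ⟨b, rfl⟩ | ⟨q, rfl⟩
    · rw [join_left hc, join_left hc]
      exact hxy b (hc.strictMono_left.lt_iff_lt.1 hk)
    · exact absurd (mem_Iio.1 hk) (hc.lt a q).not_gt
  have hright : ∀ (q : Q) (x : E → X) (z z' : Q → X), (∀ k < q, z k = z' k) →
      S.allowed (e₂ q) (join e₁ e₂ x z) = S.allowed (e₂ q) (join e₁ e₂ x z') := by
    refine fun q x z z' hz => S.dependsOn _ fun k hk => ?_
    rcases hc.cover k with ⟨b, rfl⟩ | ⟨q', rfl⟩
    · rw [join_left hc, join_left hc]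
    · rw [join_right hc, join_right hc]
      exact hz q' (hc.strictMono_right.lt_iff_lt.1 hk)
  let z₀ : Q → X := fun _ => Classical.arbitrary X
  refine ⟨⟨fun a x => S.allowed (e₁ a) (join e₁ e₂ x z₀), fun a x => S.allowed_mem _ _,
    fun a x y hxy => hleft a x y _ _ hxy⟩, fun x hx => ?_⟩
  refine ⟨⟨fun q z => S.allowed (e₂ q) (join e₁ e₂ x z), fun q z => S.allowed_mem _ _,
    fun q z z' hzz' => hright q x z z' hzz'⟩, fun z hz => hS fun n => ?_⟩
  rcases hc.cover n with ⟨a, rfl⟩ | ⟨q, rfl⟩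
  · rw [join_left hc, hleft a x x z z₀ fun _ _ => rfl]
    exact hx a
  · rw [join_right hc]
    exact hz q

end Concat

/-! ### The transitive collapse of an iterated ultrapower of the universe -/

section Collapse

variable {L X : Type u} [LinearOrder L] (U : L → SigmaUltrafilter X)

/-- Membership in the iterated ultrapower of the universe, between representing functions. -/
def UMem (G F : (L → X) → ZFSet.{u}) : Prop := Finitary G ∧ ∀ᶠ x in iterFilter U, G x ∈ F x

/-- The members of `F` in the ultrapower that are everywhere in `F` or `∅`. All members are of this
form up to equality almost everywhere, and in contrast to all members they form a small type. -/
def Selector (F : (L → X) → ZFSet.{u}) : Type (u + 1) :=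
  {G : (L → X) → ZFSet.{u} // UMem U G F ∧ ∀ x, G x ∈ insert ∅ (F x)}

instance small_selector (F : (L → X) → ZFSet.{u}) : Small.{u} (Selector U F) := by
  have h : Small.{u} (∀ x : L → X, (insert ∅ (F x) : ZFSet.{u})) := inferInstance
  refine small_of_injective (β := ∀ x : L → X, (insert ∅ (F x) : ZFSet.{u}))
    (f := fun G x => ⟨G.1 x, G.2.2 x⟩) fun G G' hG => Subtype.ext (funext fun x => ?_)
  exact congrArg Subtype.val (congrFun hG x)

variable {U}

theorem exists_selector {F G : (L → X) → ZFSet.{u}} (hF : Finitary F) (hG : UMem U G F) :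
    ∃ G' : Selector U F, G =ᶠ[iterFilter U] G'.1 := by
  classical
  have heq : G =ᶠ[iterFilter U] fun x => if G x ∈ F x then G x else ∅ :=
    hG.2.mono fun x hx => (if_pos hx).symm
  refine ⟨⟨_, ⟨hG.1.comp₂ hF fun a b => if a ∈ b then a else ∅, ?_⟩, fun x => ?_⟩, heq⟩
  · filter_upwards [hG.2] with x hx
    rwa [if_pos hx]
  · split_ifs with hx <;> simp [hx]

variable (U) [WellFoundedLT L] [Nonempty X]

theorem wellFounded_uMem : WellFounded (UMem U) := by
  rw [wellFounded_iff_isEmpty_descending_chain]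
  refine ⟨fun ⟨f, hf⟩ => ?_⟩
  have h : ∀ᶠ x in iterFilter U, ∀ n, f (n + 1) x ∈ f n x :=
    eventually_countable_forall.2 fun n => (hf n).2
  obtain ⟨x, hx⟩ := h.exists
  exact (wellFounded_iff_isEmpty_descending_chain.1 ZFSet.mem_wf).false ⟨fun n => f n x, hx⟩

/-- The transitive collapse of the iterated ultrapower of the universe, on representing
functions. -/
noncomputable def collapse : ((L → X) → ZFSet.{u}) → ZFSet.{u} :=
  (wellFounded_uMem U).fix fun F c => ZFSet.range fun G : Selector U F => c G.1 G.2.1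

theorem collapse_eq (F : (L → X) → ZFSet.{u}) :
    collapse U F = ZFSet.range fun G : Selector U F => collapse U G.1 :=
  WellFounded.fix_eq _ _ _

variable {U}

theorem mem_collapse {F : (L → X) → ZFSet.{u}} {y : ZFSet.{u}} :
    y ∈ collapse U F ↔
      ∃ G, Finitary G ∧ (∀ x, G x ∈ insert ∅ (F x)) ∧ (∀ᶠ x in iterFilter U, G x ∈ F x) ∧
        collapse U G = y := by
  rw [collapse_eq, ZFSet.mem_range]
  exact ⟨fun ⟨G, h⟩ => ⟨G.1, G.2.1.1, G.2.2, G.2.1.2, h⟩,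
    fun ⟨G, h1, h2, h3, h4⟩ => ⟨⟨G, ⟨h1, h3⟩, h2⟩, h4⟩⟩

theorem collapse_congr {F F' : (L → X) → ZFSet.{u}} (h : F =ᶠ[iterFilter U] F')
    (hF : Finitary F) (hF' : Finitary F') : collapse U F = collapse U F' := by
  have hsub : ∀ F : (L → X) → ZFSet.{u}, ∀ F', Finitary F' → F =ᶠ[iterFilter U] F' →
      collapse U F ⊆ collapse U F' := by
    intro F
    induction F using (wellFounded_uMem U).induction with
    | _ F ih =>
      intro F' hF' h y hy
      obtain ⟨G, hG, -, hGF, rfl⟩ := mem_collapse.1 hy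
      obtain ⟨G', hGG'⟩ := exists_selector hF' ⟨hG, h.mp (hGF.mono fun x hx h => h ▸ hx)⟩
      have hG'F : UMem U G'.1 F :=
        ⟨G'.2.1.1, hGG'.mp (hGF.mono fun x hx h => h ▸ hx)⟩
      rw [collapse_eq, ZFSet.mem_range]
      exact ⟨G', subset_antisymm (ih G'.1 hG'F G hG hGG'.symm)
        (ih G ⟨hG, hGF⟩ G'.1 G'.2.1.1 hGG')⟩
  exact subset_antisymm (hsub F F' hF' h) (hsub F' F hF h.symm)

theorem collapse_mem_collapse {F G : (L → X) → ZFSet.{u}} (hF : Finitary F) (hG : Finitary G)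
    (h : ∀ᶠ x in iterFilter U, G x ∈ F x) : collapse U G ∈ collapse U F := by
  obtain ⟨G', hGG'⟩ := exists_selector hF ⟨hG, h⟩
  rw [collapse_congr hGG' hG G'.2.1.1, collapse_eq, ZFSet.mem_range]
  exact ⟨G', rfl⟩

theorem eventually_subset_of_collapse_subset {F G : (L → X) → ZFSet.{u}} (hF : Finitary F)
    (hG : Finitary G)
    (hinj : ∀ H H', UMem U H F → UMem U H' G → collapse U H = collapse U H' →
      H =ᶠ[iterFilter U] H')
    (h : collapse U F ⊆ collapse U G) : ∀ᶠ x in iterFilter U, F x ⊆ G x := by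
  refine (hF.comp₂ hG (· ⊆ ·)).eventually_or_not.resolve_right fun hnot => ?_
  let H : (L → X) → ZFSet.{u} := fun x => Classical.epsilon fun w => w ∈ F x ∧ w ∉ G x
  have hH : Finitary H := hF.comp₂ hG fun a b => Classical.epsilon fun w => w ∈ a ∧ w ∉ b
  have hHFG : ∀ᶠ x in iterFilter U, H x ∈ F x ∧ H x ∉ G x := by
    filter_upwards [hnot] with x hx
    refine Classical.epsilon_spec (p := fun w => w ∈ F x ∧ w ∉ G x) ?_
    by_contra! hcon
    exact hx hcon
  have hHF := hHFG.mono fun _ hx => hx.1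
  obtain ⟨H', hH', -, hH'G, heq⟩ := mem_collapse.1 (h (collapse_mem_collapse hF hH hHF))
  obtain ⟨x, hx, hx', hxG⟩ :=
    ((hinj H H' ⟨hH, hHF⟩ ⟨hH', hH'G⟩ heq.symm).and (hHFG.and hH'G)).exists
  exact hx'.2 (hx ▸ hxG)

theorem collapse_eq_iff {F G : (L → X) → ZFSet.{u}} (hF : Finitary F) (hG : Finitary G) :
    collapse U F = collapse U G ↔ ∀ᶠ x in iterFilter U, F x = G x := by
  refine ⟨?_, fun h => collapse_congr h hF hG⟩
  induction F using (wellFounded_uMem U).induction generalizing G with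
  | _ F ih =>
    intro hFG
    have hle : ∀ᶠ x in iterFilter U, F x ⊆ G x := eventually_subset_of_collapse_subset hF hG
      (fun H H' hH hH' heq => ih H hH hH.1 hH'.1 heq) hFG.subset
    have hge : ∀ᶠ x in iterFilter U, G x ⊆ F x := eventually_subset_of_collapse_subset hG hF
      (fun H H' hH hH' heq => EventuallyEq.symm (ih H' hH' hH'.1 hH.1 heq.symm)) hFG.superset
    filter_upwards [hle, hge] with x h h' using subset_antisymm h h'

theorem collapse_mem_iff {F G : (L → X) → ZFSet.{u}} (hF : Finitary F) (hG : Finitary G) :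
    collapse U G ∈ collapse U F ↔ ∀ᶠ x in iterFilter U, G x ∈ F x := by
  refine ⟨fun h => ?_, collapse_mem_collapse hF hG⟩
  obtain ⟨H, hH, -, hHF, he⟩ := mem_collapse.1 h
  filter_upwards [(collapse_eq_iff hH hG).1 he, hHF] with x h1 h2 using h1 ▸ h2

/-- The quantifier step of the theorem of Łoś. -/
theorem exists_mem_collapse_iff {F : (L → X) → ZFSet.{u}} (hF : Finitary F)
    {P : ZFSet.{u} → Prop} {Q : (L → X) → ZFSet.{u} → Prop} (hQ : Finitary Q)
    (hPQ : ∀ G, Finitary G → (P (collapse U G) ↔ ∀ᶠ x in iterFilter U, Q x (G x))) :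
    (∃ a ∈ collapse U F, P a) ↔ ∀ᶠ x in iterFilter U, ∃ a ∈ F x, Q x a := by
  constructor
  · rintro ⟨a, ha, hPa⟩
    obtain ⟨G, hG, -, hGF, rfl⟩ := mem_collapse.1 ha
    filter_upwards [hGF, (hPQ G hG).1 hPa] with x h1 h2 using ⟨G x, h1, h2⟩
  · intro h
    let G : (L → X) → ZFSet.{u} := fun x => Classical.epsilon fun a => a ∈ F x ∧ Q x a
    have hG : Finitary G := hF.comp₂ hQ fun z q => Classical.epsilon fun a => a ∈ z ∧ q a
    have hGF : ∀ᶠ x in iterFilter U, G x ∈ F x ∧ Q x (G x) :=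
      h.mono fun x hx => Classical.epsilon_spec (p := fun a => a ∈ F x ∧ Q x a) hx
    exact ⟨collapse U G, collapse_mem_collapse hF hG (hGF.mono fun _ hx => hx.1),
      (hPQ G hG).2 (hGF.mono fun _ hx => hx.2)⟩

theorem forall_mem_collapse_iff {F : (L → X) → ZFSet.{u}} (hF : Finitary F)
    {P : ZFSet.{u} → Prop} {Q : (L → X) → ZFSet.{u} → Prop} (hQ : Finitary Q)
    (hPQ : ∀ G, Finitary G → (P (collapse U G) ↔ ∀ᶠ x in iterFilter U, Q x (G x))) :
    (∀ a ∈ collapse U F, P a) ↔ ∀ᶠ x in iterFilter U, ∀ a ∈ F x, Q x a := by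
  have hex : (∃ a ∈ collapse U F, ¬ P a) ↔ ∀ᶠ x in iterFilter U, ∃ a ∈ F x, ¬ Q x a :=
    exists_mem_collapse_iff hF (hQ.comp fun q a => ¬ q a) fun G hG =>
      (not_congr (hPQ G hG)).trans (hQ.comp₂ hG fun q a => q a).eventually_not.symm
  have hfin : Finitary fun x => ∃ a ∈ F x, ¬ Q x a := hF.comp₂ hQ fun z q => ∃ a ∈ z, ¬ q a
  simpa only [← hfin.eventually_not, not_exists, not_and, not_not] using not_congr hex

variable (U)

/-- The elementary embedding of the universe into the collapsed iterated ultrapower. -/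
noncomputable def emb (y : ZFSet.{u}) : ZFSet.{u} := collapse U fun _ => y

end Collapse

/-! ### The theorem of Łoś for bounded formulas -/

section Los

open PerfectSubset FirstOrder Language BoundedFormula

theorem langSet_term_eq_var {β : Type} (t : langSet.Term β) : ∃ v, t = Term.var v := by
  cases t with
  | var v => exact ⟨v, rfl⟩
  | func f _ => exact f.elim

theorem realize_memFormula {α : Type} {n : ℕ} (t s : langSet.Term (α ⊕ Fin n))
    (v : α → ZFSet.{u}) (xs : Fin n → ZFSet.{u}) :
    (memFormula t s).Realize v xs ↔
      t.realize (Sum.elim v xs) ∈ s.realize (Sum.elim v xs) := by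
  rw [memFormula, BoundedFormula.realize_rel₂]
  rfl

theorem realize_lastVar {α : Type} {n : ℕ} (v : α → ZFSet.{u}) (xs : Fin n → ZFSet.{u})
    (a : ZFSet.{u}) :
    (lastVar : langSet.Term (α ⊕ Fin (n + 1))).realize (Sum.elim v (Fin.snoc xs a)) = a := by
  simp [lastVar]

theorem realize_liftVar {α : Type} {n : ℕ} (w : α ⊕ Fin n) (v : α → ZFSet.{u})
    (xs : Fin n → ZFSet.{u}) (a : ZFSet.{u}) :
    (liftVar w).realize (Sum.elim v (Fin.snoc xs a)) = Sum.elim v xs w := by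
  cases w <;> simp [liftVar]

theorem realize_ball_iff {α : Type} {n : ℕ} {w : α ⊕ Fin n} {φ : langSet.BoundedFormula α (n + 1)}
    {v : α → ZFSet.{u}} {xs : Fin n → ZFSet.{u}} :
    (BoundedFormula.all ((memFormula lastVar (liftVar w)).imp φ)).Realize v xs ↔
      ∀ a ∈ Sum.elim v xs w, φ.Realize v (Fin.snoc xs a) := by
  simp only [BoundedFormula.realize_all, BoundedFormula.realize_imp, realize_memFormula,
    realize_lastVar, realize_liftVar]

theorem realize_bex_iff {α : Type} {n : ℕ} {w : α ⊕ Fin n} {φ : langSet.BoundedFormula α (n + 1)}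
    {v : α → ZFSet.{u}} {xs : Fin n → ZFSet.{u}} :
    (BoundedFormula.ex (memFormula lastVar (liftVar w) ⊓ φ)).Realize v xs ↔
      ∃ a ∈ Sum.elim v xs w, φ.Realize v (Fin.snoc xs a) := by
  simp only [BoundedFormula.realize_ex, BoundedFormula.realize_inf, realize_memFormula,
    realize_lastVar, realize_liftVar]

theorem Finitary.sumElim {L X A α β : Type*} {v : α → (L → X) → A} {w : β → (L → X) → A}
    (hv : ∀ a, Finitary (v a)) (hw : ∀ b, Finitary (w b)) (c : α ⊕ β) :
    Finitary (Sum.elim v w c) :=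
  Sum.rec hv hw c

theorem Finitary.snoc {L X A : Type*} {n : ℕ} {v : Fin n → (L → X) → A} {F : (L → X) → A}
    (hv : ∀ i, Finitary (v i)) (hF : Finitary F) (i : Fin (n + 1)) :
    Finitary ((Fin.snoc v F : Fin (n + 1) → (L → X) → A) i) := by
  refine Fin.lastCases ?_ (fun i => ?_) i <;> simp [hF, hv]

theorem sumElim_eval {I A α β : Type*} (v : α → I → A) (w : β → I → A) (x : I) (c : α ⊕ β) :
    Sum.elim (fun a => v a x) (fun b => w b x) c = Sum.elim v w c x := by
  cases c <;> rfl

variable {L X : Type u} [LinearOrder L] [WellFoundedLT L] [Nonempty X] {U : L → SigmaUltrafilter X}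
  {α : Type} {n : ℕ} (v : α → (L → X) → ZFSet.{u}) (xs : Fin n → (L → X) → ZFSet.{u})

theorem sumElim_collapse (w : α ⊕ Fin n) :
    Sum.elim (fun a => collapse U (v a)) (fun i => collapse U (xs i)) w =
      collapse U (Sum.elim v xs w) := by
  cases w <;> rfl

/-- The quantifier step of the theorem of Łoś, as it is needed in an induction on formulas. -/
theorem realize_collapse_snoc_iff {v : α → (L → X) → ZFSet.{u}} {xs : Fin n → (L → X) → ZFSet.{u}}
    {φ : langSet.BoundedFormula α (n + 1)} (hxs : ∀ i, Finitary (xs i))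
    (ih : ∀ ys : Fin (n + 1) → (L → X) → ZFSet.{u}, (∀ i, Finitary (ys i)) →
      (φ.Realize (fun a => collapse U (v a)) (fun i => collapse U (ys i)) ↔
        ∀ᶠ x in iterFilter U, φ.Realize (fun a => v a x) (fun i => ys i x)))
    (G : (L → X) → ZFSet.{u}) (hG : Finitary G) :
    φ.Realize (fun a => collapse U (v a))
        (Fin.snoc (fun i => collapse U (xs i)) (collapse U G)) ↔
      ∀ᶠ x in iterFilter U, φ.Realize (fun a => v a x) (Fin.snoc (fun i => xs i x) (G x)) := by
  have hsnoc : ∀ g : ((L → X) → ZFSet.{u}) → ZFSet.{u},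
      (Fin.snoc (fun i => g (xs i)) (g G) : Fin (n + 1) → ZFSet.{u}) =
        fun i => g ((Fin.snoc xs G : Fin (n + 1) → (L → X) → ZFSet.{u}) i) :=
    fun g => (Fin.comp_snoc g xs G).symm
  rw [hsnoc (collapse U), ih _ (Finitary.snoc hxs hG)]
  exact eventually_congr (Eventually.of_forall fun x => by rw [hsnoc fun F => F x])

theorem realize_collapse_iff [Finite α] {φ : langSet.BoundedFormula α n} (hφ : IsDelta0 φ)
    (hv : ∀ a, Finitary (v a)) (hxs : ∀ i, Finitary (xs i)) :
    φ.Realize (fun a => collapse U (v a)) (fun i => collapse U (xs i)) ↔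
      ∀ᶠ x in iterFilter U, φ.Realize (fun a => v a x) (fun i => xs i x) := by
  induction hφ with
  | falsum =>
    simp only [BoundedFormula.Realize, eventually_false_iff_eq_bot, false_iff]
    exact NeBot.ne inferInstance
  | equal t s =>
    obtain ⟨t, rfl⟩ := langSet_term_eq_var t
    obtain ⟨s, rfl⟩ := langSet_term_eq_var s
    simp only [BoundedFormula.Realize, Term.realize_var, sumElim_collapse, sumElim_eval]
    exact collapse_eq_iff (.sumElim hv hxs t) (.sumElim hv hxs s)
  | mem t s =>
    obtain ⟨t, rfl⟩ := langSet_term_eq_var t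
    obtain ⟨s, rfl⟩ := langSet_term_eq_var s
    simp only [realize_memFormula, Term.realize_var, sumElim_collapse, sumElim_eval]
    exact collapse_mem_iff (.sumElim hv hxs s) (.sumElim hv hxs t)
  | @imp m φ ψ _ _ ihφ ihψ =>
    have hfin : Finitary fun x => φ.Realize (fun a => v a x) (fun i => xs i x) :=
      (Finitary.pi hv).comp₂ (Finitary.pi hxs) fun p q => φ.Realize p q
    simp only [BoundedFormula.realize_imp, ihφ xs hxs, ihψ xs hxs, hfin.eventually_imp]
  | @ball m w φ _ ih =>
    simp only [realize_ball_iff, sumElim_collapse, sumElim_eval]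
    exact forall_mem_collapse_iff (.sumElim hv hxs w)
      ((Finitary.pi hv).comp₂ (Finitary.pi hxs) fun p q a => φ.Realize p (Fin.snoc q a))
      (realize_collapse_snoc_iff hxs ih)
  | @bex m w φ _ ih =>
    simp only [realize_bex_iff, sumElim_collapse, sumElim_eval]
    exact exists_mem_collapse_iff (.sumElim hv hxs w)
      ((Finitary.pi hv).comp₂ (Finitary.pi hxs) fun p q a => φ.Realize p (Fin.snoc q a))
      (realize_collapse_snoc_iff hxs ih)

theorem realize_emb_of_isSigma1 [Finite α] {φ : langSet.BoundedFormula α n} (hφ : IsSigma1 φ)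
    {v : α → ZFSet.{u}} {xs : Fin n → ZFSet.{u}} (h : φ.Realize v xs) :
    φ.Realize (fun a => emb U (v a)) (fun i => emb U (xs i)) := by
  induction hφ with
  | of_delta0 hφ =>
    exact (realize_collapse_iff (fun a _ => v a) (fun i _ => xs i) hφ (fun _ => .const _)
      fun _ => .const _).2 (Eventually.of_forall fun _ => h)
  | ex _ ih =>
    rw [BoundedFormula.realize_ex] at h ⊢
    obtain ⟨a, ha⟩ := h
    refine ⟨emb U a, ?_⟩
    rw [← Function.comp_def (emb U) xs, ← Fin.comp_snoc]
    exact ih ha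

end Los

/-! ### Ordinals in the iterated ultrapower -/

section Ordinals

variable {L X : Type u} [LinearOrder L] [WellFoundedLT L] [Nonempty X] {U : L → SigmaUltrafilter X}

theorem isOrdinal_collapse {F : (L → X) → ZFSet.{u}} (hFfin : Finitary F)
    (hF : ∀ x, (F x).IsOrdinal) : (collapse U F).IsOrdinal := by
  induction F using (wellFounded_uMem U).induction with
  | _ F ih =>
    rw [ZFSet.isOrdinal_iff_forall_mem_isOrdinal]
    refine ⟨fun y hy z hz => ?_, fun y hy => ?_⟩
    · obtain ⟨G, -, -, hGF, rfl⟩ := mem_collapse.1 hy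
      obtain ⟨H, hH, -, hHG, rfl⟩ := mem_collapse.1 hz
      refine collapse_mem_collapse hFfin hH ?_
      filter_upwards [hGF, hHG] with x h1 h2 using (hF x).mem_trans h2 h1
    · obtain ⟨G, hG, hG', hGF, rfl⟩ := mem_collapse.1 hy
      refine ih G ⟨hG, hGF⟩ hG fun x => ?_
      rcases ZFSet.mem_insert_iff.1 (hG' x) with h | h
      · exact h ▸ ZFSet.isOrdinal_empty
      · exact (hF x).mem h

variable (U)

/-- The ordinal that is represented by an ordinal valued function in the iterated ultrapower. -/
noncomputable def collapseOrd (h : (L → X) → Ordinal.{u}) : Ordinal.{u} :=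
  (collapse U fun x => (h x).toZFSet).rank

/-- The restriction of the embedding into the iterated ultrapower to the ordinals. -/
noncomputable def embOrd (θ : Ordinal.{u}) : Ordinal.{u} := collapseOrd U fun _ => θ

variable {U}

theorem toZFSet_collapseOrd {h : (L → X) → Ordinal.{u}} (hh : Finitary h) :
    (collapseOrd U h).toZFSet = collapse U fun x => (h x).toZFSet :=
  (isOrdinal_collapse (hh.comp _) fun x => ZFSet.isOrdinal_toZFSet (h x)).toZFSet_rank_eq

theorem emb_toZFSet (θ : Ordinal.{u}) : emb U θ.toZFSet = (embOrd U θ).toZFSet :=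
  (toZFSet_collapseOrd (.const θ)).symm

theorem collapseOrd_lt_iff {g h : (L → X) → Ordinal.{u}} (hg : Finitary g) (hh : Finitary h) :
    collapseOrd U g < collapseOrd U h ↔ ∀ᶠ x in iterFilter U, g x < h x := by
  rw [← Ordinal.toZFSet_mem_toZFSet_iff, toZFSet_collapseOrd hg, toZFSet_collapseOrd hh,
    collapse_mem_iff (hh.comp _) (hg.comp _)]
  simp only [Ordinal.toZFSet_mem_toZFSet_iff]

theorem collapseOrd_eq_iff {g h : (L → X) → Ordinal.{u}} (hg : Finitary g) (hh : Finitary h) :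
    collapseOrd U g = collapseOrd U h ↔ ∀ᶠ x in iterFilter U, g x = h x := by
  rw [← Ordinal.toZFSet_injective.eq_iff, toZFSet_collapseOrd hg, toZFSet_collapseOrd hh,
    collapse_eq_iff (hg.comp _) (hh.comp _)]
  simp only [Ordinal.toZFSet_injective.eq_iff]

theorem embOrd_strictMono : StrictMono (embOrd U) := fun a b h =>
  (collapseOrd_lt_iff (.const a) (.const b)).2 (Eventually.of_forall fun _ => h)

theorem le_embOrd (θ : Ordinal.{u}) : θ ≤ embOrd U θ := embOrd_strictMono.le_apply

theorem toZFSet_collapseOrd_mem_emb {h : (L → X) → Ordinal.{u}} (hh : Finitary h)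
    {y : ZFSet.{u}} :
    (collapseOrd U h).toZFSet ∈ emb U y ↔ ∀ᶠ x in iterFilter U, (h x).toZFSet ∈ y := by
  rw [toZFSet_collapseOrd hh]
  exact collapse_mem_iff (.const y) (hh.comp _)

theorem exists_collapseOrd_eq_of_lt_embOrd {θ c : Ordinal.{u}} (h : θ < embOrd U c) :
    ∃ g : (L → X) → Ordinal.{u}, Finitary g ∧ (∀ x, g x < c) ∧ collapseOrd U g = θ := by
  rw [← Ordinal.toZFSet_mem_toZFSet_iff, ← emb_toZFSet] at h
  obtain ⟨G, hG, hG', hGc, he⟩ := mem_collapse.1 h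
  have hc : c ≠ 0 := by
    rintro rfl
    obtain ⟨x, hx⟩ := hGc.exists
    simp at hx
  have hcases : ∀ x, G x = ∅ ∨ G x ∈ c.toZFSet := fun x => ZFSet.mem_insert_iff.1 (hG' x)
  have hrank : ∀ x, (G x).rank.toZFSet = G x := fun x => ZFSet.IsOrdinal.toZFSet_rank_eq <|
    (hcases x).elim (fun hx => hx ▸ ZFSet.isOrdinal_empty) (ZFSet.isOrdinal_toZFSet _).mem
  refine ⟨fun x => (G x).rank, hG.comp _, fun x => ?_, ?_⟩
  · rcases hcases x with hx | hx
    · simpa [hx] using pos_iff_ne_zero.2 hc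
    · simpa using ZFSet.rank_lt_of_mem hx
  · simp only [collapseOrd, hrank]
    rw [he, Ordinal.rank_toZFSet]

theorem exists_collapseOrd_eq_of_lt {c θ : Ordinal.{u}} (h : θ < c) :
    ∃ g : (L → X) → Ordinal.{u}, Finitary g ∧ (∀ x, g x < c) ∧ collapseOrd U g = θ :=
  exists_collapseOrd_eq_of_lt_embOrd (h.trans_le (le_embOrd c))

theorem collapseOrd_le_embOrd {h : (L → X) → Ordinal.{u}} (hh : Finitary h) {θ : Ordinal.{u}}
    (hle : ∀ᶠ x in iterFilter U, h x ≤ θ) : collapseOrd U h ≤ embOrd U θ := by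
  refine le_of_not_gt fun hlt => ?_
  obtain ⟨x, hx, hx'⟩ := (((collapseOrd_lt_iff (.const θ) hh).1 hlt).and hle).exists
  exact hx.not_ge hx'

theorem embOrd_eq_self_of_bounded {o : Ordinal.{u}}
    (hbounded : ∀ g : (L → X) → Ordinal.{u}, Finitary g → (∀ x, g x < o) →
      ∃ θ < o, ∀ᶠ x in iterFilter U, g x ≤ θ)
    (hlt : ∀ θ < o, embOrd U θ < o) : embOrd U o = o := by
  refine le_antisymm (le_of_not_gt fun h => ?_) (le_embOrd o)
  obtain ⟨g, hg, hgo, he⟩ := exists_collapseOrd_eq_of_lt_embOrd h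
  obtain ⟨θ, hθ, hgθ⟩ := hbounded g hg hgo
  exact ((collapseOrd_le_embOrd hg hgθ).trans_lt (hlt θ hθ)).ne he

end Ordinals

/-! ### Independence of the later stages -/

section SmallSet

variable {A : Type*} {c : Cardinal.{u}}

/-- The set `K` has fewer than `c` elements. A covering by a type in the universe of `c` allows
one to apply the completeness of filters. -/
def SmallSet (c : Cardinal.{u}) (K : Set A) : Prop :=
  ∃ (τ : Type u) (φ : τ → A), #τ < c ∧ K ⊆ range φ

theorem SmallSet.exists_eventually_eq {K : Set A} (hK : SmallSet c K) {B : Type u} {l : Filter B}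
    [l.NeBot] [CardinalInterFilter l c] {g : B → A}
    (hl : ∀ a, (∀ᶠ z in l, g z = a) ∨ ∀ᶠ z in l, g z ≠ a) (hg : ∀ᶠ z in l, g z ∈ K) :
    ∃ a, ∀ᶠ z in l, g z = a := by
  obtain ⟨τ, φ, hτ, hφ⟩ := hK
  by_contra hcon
  have hne : ∀ᶠ z in l, ∀ t, g z ≠ φ t :=
    (eventually_cardinal_forall hτ).2 fun t => (hl (φ t)).resolve_left fun h => hcon ⟨_, h⟩
  obtain ⟨z, hz, hzK⟩ := (hne.and hg).exists
  obtain ⟨t, ht⟩ := hφ hzK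
  exact hz t ht.symm

theorem smallSet_toZFSet {θ : Ordinal.{u}} (h : θ < c.ord) :
    SmallSet c {s | s ∈ θ.toZFSet} := by
  refine ⟨θ.ToType, fun i => (Ordinal.ToType.toOrd i).1.toZFSet, ?_, fun s hs => ?_⟩
  · rw [mk_toType]
    exact lt_ord.1 h
  · obtain ⟨a, ha, rfl⟩ := Ordinal.mem_toZFSet_iff.1 hs
    exact ⟨Ordinal.ToType.mk ⟨a, ha⟩, by simp⟩

/-- A transitive class all of whose members have fewer than `c` elements. -/
structure IsSmallTransitive (c : Cardinal.{u}) (T : Set ZFSet.{u}) : Prop where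
  mem_of_mem : ∀ t ∈ T, ∀ s ∈ t, s ∈ T
  smallSet : ∀ t ∈ T, SmallSet c {s | s ∈ t}

theorem IsSmallTransitive.empty_mem {T : Set ZFSet.{u}} (hT : IsSmallTransitive c T) {t : ZFSet.{u}}
    (ht : t ∈ T) : ∅ ∈ T := by
  induction t using ZFSet.inductionOn with
  | _ t ih =>
    rcases t.eq_empty_or_nonempty with rfl | ⟨s, hs⟩
    · exact ht
    · exact ih s hs (hT.mem_of_mem t ht s hs)

theorem IsSmallTransitive.mem_of_mem_insert {T : Set ZFSet.{u}} (hT : IsSmallTransitive c T)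
    {s t : ZFSet.{u}} (ht : t ∈ T) (hs : s ∈ insert ∅ t) : s ∈ T := by
  rcases ZFSet.mem_insert_iff.1 hs with rfl | hs
  · exact hT.empty_mem ht
  · exact hT.mem_of_mem t ht s hs

theorem isSmallTransitive_image_toZFSet :
    IsSmallTransitive c (Ordinal.toZFSet '' Iio c.ord) where
  mem_of_mem := by
    rintro _ ⟨a, ha, rfl⟩ s hs
    obtain ⟨b, hb, rfl⟩ := Ordinal.mem_toZFSet_iff.1 hs
    exact ⟨b, hb.trans ha, rfl⟩
  smallSet := by
    rintro _ ⟨a, ha, rfl⟩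
    exact smallSet_toZFSet ha

end SmallSet

section EndExtension

variable {L L₁ X : Type u} [LinearOrder L] [LinearOrder L₁]

/-- The iteration along `U` extends the iteration along `U₁` by later stages, at all of which the
ultrafilters are `c`-complete. The map `e` identifies `U₁` with an initial part of `U`. -/
structure IsEndExtension (c : Cardinal.{u}) (U₁ : L₁ → SigmaUltrafilter X)
    (U : L → SigmaUltrafilter X) (e : L₁ → L) : Prop where
  strictMono : StrictMono e
  apply_eq : ∀ a, U (e a) = U₁ a
  lt_of_notMem_range : ∀ i ∉ range e, ∀ a, e a < i
  cardinalInterFilter : ∀ i ∉ range e, CardinalInterFilter ((U i).1 : Filter X) c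

variable [WellFoundedLT L] [Nonempty X] {c : Cardinal.{u}} {U : L → SigmaUltrafilter X}
  {U₁ : L₁ → SigmaUltrafilter X} {e : L₁ → L}

theorem exists_eventually_eq_of_dependsOn_insert {A : Type*} {a : L}
    [CardinalInterFilter ((U a).1 : Filter X) c] {s : Finset L} (has : ∀ i ∈ s, i < a)
    {g : (L → X) → A} (hg : DependsOn g (insert a (s : Set L))) {K : (L → X) → Set A}
    (hK : Finitary K) (hKa : DependsOn K (Iio a)) (hKc : ∀ x, SmallSet c (K x))
    (hgK : ∀ᶠ x in iterFilter U, g x ∈ K x) :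
    ∃ g₁ : (L → X) → A, DependsOn g₁ (s : Set L) ∧ g =ᶠ[iterFilter U] g₁ := by
  classical
  have : Nonempty A := ⟨g fun _ => Classical.arbitrary X⟩
  have hgfin : Finitary g := ⟨insert a s, by rwa [Finset.coe_insert]⟩
  have hgIic : DependsOn g (Iic a) := hg.mono (insert_subset le_rfl fun i hi => (has i hi).le)
  have hupdate := dependsOn_comp_update hg
  -- Replace the value of `g` by the one that it takes for almost all choices at stage `a`.
  let g₁ : (L → X) → A := fun x =>
    Classical.epsilon fun b => ∀ᶠ z in (U a).1, g (Function.update x a z) = b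
  have hg₁ : DependsOn g₁ (s : Set L) := fun x y h =>
    congrArg (fun q : X → A => Classical.epsilon fun b => ∀ᶠ z in (U a).1, q z = b) (hupdate h)
  have hmem : ∀ᶠ x in iterFilter U, ∀ᶠ z in (U a).1, g (Function.update x a z) ∈ K x := by
    refine ((eventually_update_iff (hgfin.comp₂ hK (· ∈ ·)) fun x y h => ?_).2 hgK).mono
      fun x hx => hx.mono fun z hz => ?_
    · exact congrArg₂ (· ∈ ·) (hgIic h) (hKa fun i hi => h i (mem_Iio.1 hi).le)
    · rwa [hKa fun i hi => Function.update_of_ne (mem_Iio.1 hi).ne _ _] at hz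
  refine ⟨g₁, hg₁, eventually_of_eventually_update (P := fun x => g x = g₁ x) (a := a)
    (fun x y h => ?_) ?_⟩
  · exact congrArg₂ (· = ·) (hgIic h) (hg₁ fun i hi => h i (has i hi).le)
  · filter_upwards [hmem] with x hx
    have hex := (hKc x).exists_eventually_eq (fun b => Ultrafilter.em _ _) hx
    filter_upwards [Classical.epsilon_spec hex] with z hz
    rw [hz]
    exact (hg₁ fun i hi => Function.update_of_ne (has i hi).ne _ _).symm

theorem IsEndExtension.exists_eventually_eq_comp_right (hE : IsEndExtension c U₁ U e) {A : Type*}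
    {K : (L₁ → X) → Set A} (hK : Finitary K) (hKc : ∀ x, SmallSet c (K x)) {g : (L → X) → A}
    (hg : Finitary g) (hgK : ∀ᶠ x in iterFilter U, g x ∈ K (x ∘ e)) :
    ∃ g' : (L₁ → X) → A, Finitary g' ∧ ∀ᶠ x in iterFilter U, g x = g' (x ∘ e) := by
  obtain ⟨s, hs⟩ := hg
  induction s using Finset.induction_on_max generalizing g with
  | empty =>
    obtain ⟨g', hg', heq⟩ :=
      exists_eq_comp_right_of_dependsOn hE.strictMono.injective hs (by simp)
    exact ⟨g', hg', .of_forall heq⟩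
  | insert a s has ih =>
    by_cases ha : a ∈ range e
    · have hrange : ((insert a s : Finset L) : Set L) ⊆ range e := by
        obtain ⟨b, rfl⟩ := ha
        rw [Finset.coe_insert]
        refine insert_subset (mem_range_self b) fun i hi => ?_
        by_contra hi'
        exact (hE.lt_of_notMem_range i hi' b).not_gt (has i hi)
      obtain ⟨g', hg', heq⟩ :=
        exists_eq_comp_right_of_dependsOn hE.strictMono.injective hs hrange
      exact ⟨g', hg', .of_forall heq⟩
    · have := hE.cardinalInterFilter a ha
      have hKa : DependsOn (fun x => K (x ∘ e)) (Iio a) := fun x y h =>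
        congrArg K (funext fun b => h _ (hE.lt_of_notMem_range a ha b))
      obtain ⟨g₁, hg₁, heq⟩ := exists_eventually_eq_of_dependsOn_insert has
        (by rwa [Finset.coe_insert] at hs) (hK.comp_right e) hKa (fun x => hKc _) hgK
      obtain ⟨g', hg', heq'⟩ := ih (heq.mp (hgK.mono fun x h h' => h' ▸ h)) hg₁
      exact ⟨g', hg', heq.trans heq'⟩

variable [WellFoundedLT L₁]

theorem IsEndExtension.collapse_comp_right (hE : IsEndExtension c U₁ U e) {T : Set ZFSet.{u}}
    (hT : IsSmallTransitive c T) {F : (L₁ → X) → ZFSet.{u}} (hF : Finitary F)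
    (hFT : ∀ x, F x ∈ T) : collapse U (fun x => F (x ∘ e)) = collapse U₁ F := by
  induction F using (wellFounded_uMem U₁).induction with
  | _ F ih =>
    have htendsto := tendsto_comp_right_iterFilter hE.strictMono hE.apply_eq
    refine subset_antisymm (fun y hy => ?_) fun y hy => ?_
    · obtain ⟨G, hG, -, hGF, rfl⟩ := mem_collapse.1 hy
      obtain ⟨g, hg, hgG⟩ := hE.exists_eventually_eq_comp_right (K := fun x => {s | s ∈ F x})
        (hF.comp fun t => {s | s ∈ t}) (fun x => hT.smallSet _ (hFT x)) hG hGF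
      have hgF : ∀ᶠ x in iterFilter U₁, g x ∈ F x :=
        ((hg.comp₂ hF (· ∈ ·)).eventually_comp_right_iff hE.strictMono hE.apply_eq).1
          (hgG.mp (hGF.mono fun x h h' => h' ▸ h))
      obtain ⟨g', hgg'⟩ := exists_selector hF ⟨hg, hgF⟩
      rw [collapse_congr (EventuallyEq.trans hgG (htendsto.eventually hgg')) hG
          (g'.2.1.1.comp_right e),
        ih g'.1 g'.2.1 g'.2.1.1 fun x => hT.mem_of_mem_insert (hFT x) (g'.2.2 x)]
      exact collapse_mem_collapse hF g'.2.1.1 g'.2.1.2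
    · obtain ⟨G, hG, hG', hGF, rfl⟩ := mem_collapse.1 hy
      rw [← ih G ⟨hG, hGF⟩ hG fun x => hT.mem_of_mem_insert (hFT x) (hG' x)]
      exact collapse_mem_collapse (hF.comp_right e) (hG.comp_right e) (htendsto.eventually hGF)

theorem IsEndExtension.collapseOrd_comp_right (hE : IsEndExtension c U₁ U e)
    {h : (L₁ → X) → Ordinal.{u}} (hh : Finitary h) (hhc : ∀ x, h x < c.ord) :
    collapseOrd U (fun x => h (x ∘ e)) = collapseOrd U₁ h :=
  congrArg ZFSet.rank <| hE.collapse_comp_right isSmallTransitive_image_toZFSet (hh.comp _)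
    fun x => mem_image_of_mem _ (hhc x)

theorem IsEndExtension.toZFSet_mem_emb_iff (hE : IsEndExtension c U₁ U e) (y : ZFSet.{u})
    {θ : Ordinal.{u}} (hθ : θ < c.ord) : θ.toZFSet ∈ emb U y ↔ θ.toZFSet ∈ emb U₁ y := by
  obtain ⟨h, hh, hhc, rfl⟩ := exists_collapseOrd_eq_of_lt (U := U₁) hθ
  rw [toZFSet_collapseOrd_mem_emb hh, ← hE.collapseOrd_comp_right hh hhc,
    toZFSet_collapseOrd_mem_emb (hh.comp_right e)]
  exact (hh.comp fun o => o.toZFSet ∈ y).eventually_comp_right_iff hE.strictMono hE.apply_eq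

theorem emb_eq_self_of_isSmallTransitive
    (hc : ∀ i, CardinalInterFilter ((U i).1 : Filter X) c) {T : Set ZFSet.{u}}
    (hT : IsSmallTransitive c T) {p : ZFSet.{u}} (hp : p ∈ T) : emb U p = p := by
  have := cardinalInterFilter_iterFilter hc
  induction p using ZFSet.inductionOn with
  | _ p ih =>
    refine subset_antisymm (fun y hy => ?_) fun y hy => ?_
    · obtain ⟨G, hG, -, hGp, rfl⟩ := mem_collapse.1 hy
      obtain ⟨t, ht⟩ := (hT.smallSet p hp).exists_eventually_eq
        (fun a => (hG.comp (· = a)).eventually_or_not) hGp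
      obtain ⟨x, hx, hxp⟩ := (ht.and hGp).exists
      have htp : t ∈ p := hx ▸ hxp
      rw [collapse_congr ht hG (.const t), ← emb, ih t htp (hT.mem_of_mem p hp t htp)]
      exact htp
    · rw [← ih y hy (hT.mem_of_mem p hp y hy)]
      exact collapse_mem_collapse (.const p) (.const y) (.of_forall fun _ => hy)

end EndExtension

/-! ### Functions on finite powers -/

section FinitePower

variable {α β : Type u}

theorem mk_finset_fun_le (s : Finset α) : #(s → β) ≤ max #β ℵ₀ := by
  rw [← power_def, mk_coe_finset]
  exact power_nat_le_max

variable {ν : Cardinal.{u}}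

theorem mk_finset_le_of_le (hν : ℵ₀ ≤ ν) (hα : #α ≤ ν) : #(Finset α) ≤ ν := by
  classical
  exact (mk_le_of_surjective List.toFinset_surjective).trans
    ((mk_list_le_max α).trans (max_le hν hα))

theorem mk_sigma_finset_fun_le (hν : ℵ₀ ≤ ν) (hα : #α ≤ 2 ^ ν) (hβ : #β ≤ ν) {A : Type u}
    (hA : #A ≤ 2 ^ ν) : #(Σ s : Finset α, (s → β) → A) ≤ 2 ^ ν := by
  have hν2 : ℵ₀ ≤ (2 : Cardinal.{u}) ^ ν := hν.trans (cantor ν).le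
  have hfiber : ∀ s : Finset α, #((s → β) → A) ≤ 2 ^ ν := fun s => calc
    #((s → β) → A) = #A ^ #(s → β) := (power_def _ _).symm
    _ ≤ (2 ^ ν) ^ #(s → β) := power_le_power_right hA
    _ ≤ (2 ^ ν) ^ ν := power_le_power_left (power_ne_zero _ two_ne_zero)
      ((mk_finset_fun_le s).trans (max_le hβ hν))
    _ = 2 ^ ν := by rw [← power_mul, mul_eq_self hν]
  calc #(Σ s : Finset α, (s → β) → A)
      ≤ #(Finset α) * 2 ^ ν := by rw [mk_sigma, ← sum_const']; exact sum_le_sum _ _ hfiber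
    _ ≤ 2 ^ ν * 2 ^ ν := mul_le_mul_left (mk_finset_le_of_le hν2 hα) _
    _ = 2 ^ ν := mul_eq_self hν2

end FinitePower

/-! ### Iterations of ultrafilters that concentrate on a small set -/

section Concentrate

variable {L X : Type u} [LinearOrder L] {U : L → SigmaUltrafilter X} {Y : Set X}

theorem eventually_apply_mem {i : L} (hY : Y ∈ (U i).1) : ∀ᶠ x in iterFilter U, x i ∈ Y := by
  refine eventually_of_eventually_update (P := fun x => x i ∈ Y)
    (fun x y h => congrArg (· ∈ Y) (h i self_mem_Iic)) (Eventually.of_forall fun x => ?_)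
  simpa using hY

theorem exists_eventually_eq_of_concentrate [Nonempty X] {A : Type*} {F : (L → X) → A}
    {s : Finset L} (hF : DependsOn F (s : Set L)) (hY : ∀ i ∈ s, Y ∈ (U i).1) :
    ∃ g : (s → Y) → A, ∀ᶠ x in iterFilter U,
      ∃ y : s → Y, (∀ i : s, x i = (y i : X)) ∧ F x = g y := by
  let d : L → X := fun _ => Classical.arbitrary X
  refine ⟨fun y => F (Function.extend Subtype.val (fun i => (y i : X)) d), ?_⟩
  filter_upwards [eventually_all.2 fun i : s => eventually_apply_mem (hY i i.2)] with x hx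
  refine ⟨fun i => ⟨x i, hx i⟩, fun i => rfl, hF fun i hi => ?_⟩
  exact (Subtype.val_injective.extend_apply (fun j : s => x j) d ⟨i, hi⟩).symm

theorem exists_eventually_le_of_concentrate [Nonempty X] {h : (L → X) → Ordinal.{u}} {s : Finset L}
    (hh : DependsOn h (s : Set L)) (hY : ∀ i ∈ s, Y ∈ (U i).1) {o : Ordinal.{u}}
    (hcof : max #Y ℵ₀ < o.cof) (ho : ∀ x, h x < o) :
    ∃ θ < o, ∀ᶠ x in iterFilter U, h x ≤ θ := by
  obtain ⟨g, hg⟩ := exists_eventually_eq_of_concentrate (F := fun x => (⟨h x, ho x⟩ : Iio o))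
    (fun x y hxy => Subtype.ext (hh hxy)) hY
  refine ⟨⨆ y, (g y : Ordinal.{u}),
    Ordinal.iSup_lt_of_lt_cof ((mk_finset_fun_le s).trans_lt hcof) fun y => (g y).2, ?_⟩
  filter_upwards [hg] with x ⟨y, _, hxy⟩
  exact (congrArg Subtype.val hxy).trans_le (Ordinal.le_iSup (fun y => (g y : Ordinal.{u})) y)

section Power

variable {ν : Cardinal.{u}}

variable [WellFoundedLT L] [Nonempty X]

theorem card_embOrd_le (hν : ℵ₀ ≤ ν) (hL : #L ≤ 2 ^ ν) (hY : ∀ i, Y ∈ (U i).1) (hYν : #Y ≤ ν)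
    {θ : Ordinal.{u}} (hθ : θ.card ≤ 2 ^ ν) : (embOrd U θ).card ≤ 2 ^ ν := by
  have hcode : ∀ η : Iio (embOrd U θ), ∃ (h : (L → X) → Ordinal.{u})
      (p : Σ s : Finset L, (s → Y) → θ.ToType), Finitary h ∧ collapseOrd U h = η ∧
      ∀ᶠ x in iterFilter U, ∃ y : p.1 → Y, (∀ i : p.1, x i = (y i : X)) ∧ h x = (p.2 y).toOrd := by
    intro η
    obtain ⟨h, ⟨s, hs⟩, hθ, hη⟩ := exists_collapseOrd_eq_of_lt_embOrd η.2
    obtain ⟨g, hg⟩ := exists_eventually_eq_of_concentrate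
      (F := fun x => Ordinal.ToType.mk ⟨h x, hθ x⟩)
      (fun x y hxy => by simp only [hs hxy]) fun i _ => hY i
    refine ⟨h, ⟨s, g⟩, ⟨s, hs⟩, hη, hg.mono fun x ⟨y, hxy, hgy⟩ => ⟨y, hxy, ?_⟩⟩
    simp [← hgy]
  choose h p hfin hη hp using hcode
  have hinj : Function.Injective p := fun η η' heq => by
    rw [← Subtype.coe_inj, ← hη, ← hη, collapseOrd_eq_iff (hfin _) (hfin _)]
    filter_upwards [hp η, heq ▸ hp η'] with x ⟨y, hxy, hhy⟩ ⟨y', hxy', hhy'⟩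
    obtain rfl : y = y' := funext fun i => Subtype.ext ((hxy i).symm.trans (hxy' i))
    exact hhy.trans hhy'.symm
  refine le_trans ?_ (mk_sigma_finset_fun_le hν hL hYν (A := θ.ToType) (by rwa [mk_toType]))
  rw [← Cardinal.lift_le.{u + 1}, ← mk_Iio_ordinal, ← lift_id'.{u, u + 1} #(Iio _)]
  exact lift_mk_le_lift_mk_of_injective hinj

theorem embOrd_ord_succ_two_power (hν : ℵ₀ ≤ ν) (hL : #L ≤ 2 ^ ν) (hY : ∀ i, Y ∈ (U i).1)
    (hYν : #Y ≤ ν) :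
    embOrd U (Order.succ ((2 : Cardinal.{u}) ^ ν)).ord =
      (Order.succ ((2 : Cardinal.{u}) ^ ν)).ord := by
  refine embOrd_eq_self_of_bounded (fun g ⟨s, hs⟩ hg => ?_) fun θ hθ => ?_
  · refine exists_eventually_le_of_concentrate hs (fun i _ => hY i) ?_ hg
    rw [(isRegular_succ (hν.trans (cantor ν).le)).cof_ord]
    exact (max_le hYν hν).trans_lt ((cantor ν).trans (Order.lt_succ _))
  · rw [lt_ord, Order.lt_succ_iff] at hθ ⊢
    exact card_embOrd_le hν hL hY hYν hθ

end Power

end Concentrate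

/-! ### Composition of iterations -/

section Composition

variable {E Q N K X : Type u} [LinearOrder E] [LinearOrder Q] [LinearOrder N]
  {e₁ : E → N} {e₂ : Q → N} {A : Type*}

theorem Finitary.exists_eventually_eq [Countable A] [Nonempty X] [WellFoundedLT E]
    {W : E → SigmaUltrafilter X} {F : (E → X) → A} (hF : Finitary F) :
    ∃ a, ∀ᶠ x in iterFilter W, F x = a := by
  by_contra hcon
  have hne : ∀ᶠ x in iterFilter W, ∀ a, F x ≠ a :=
    eventually_countable_forall.2 fun a => (hF.comp (· = a)).eventually_not.2 fun ha => hcon ⟨a, ha⟩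
  obtain ⟨x, hx⟩ := hne.exists
  exact hx _ rfl

section Enumeration

variable [LinearOrder K]

/-- The functions `h q`, for `q : Q`, represent the elements of the image of the order `K` in the
iterated ultrapower by `W`, in increasing order. -/
structure EnumeratesUltrapower (W : E → SigmaUltrafilter X) (h : Q → (E → X) → K) : Prop where
  finitary : ∀ q, Finitary (h q)
  lt : ∀ q q', q < q' → ∀ᶠ x in iterFilter W, h q x < h q' x
  surj : ∀ u : (E → X) → K, Finitary u → ∃ q, ∀ᶠ x in iterFilter W, u x = h q x

namespace EnumeratesUltrapower

variable {W : E → SigmaUltrafilter X} {h : Q → (E → X) → K}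

theorem eventually_strictMono (hh : EnumeratesUltrapower W h) (t : Finset Q) :
    ∀ᶠ x in iterFilter W, StrictMono fun q : t => h q x := by
  refine eventually_all.2 fun q => eventually_all.2 fun q' => ?_
  by_cases hq : q < q'
  · exact (hh.lt q q' hq).mono fun x hx _ => hx
  · exact Eventually.of_forall fun x hq' => absurd hq' hq

theorem exists_finset_cover [Nonempty X] [WellFoundedLT E] (hh : EnumeratesUltrapower W h)
    {σ : (E → X) → Finset K} (hσ : Finitary σ) :
    ∃ t : Finset Q, ∀ᶠ x in iterFilter W, ∀ k ∈ σ x, ∃ q ∈ t, h q x = k := by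
  classical
  obtain ⟨n, hn⟩ := (hσ.comp Finset.card).exists_eventually_eq (W := W)
  have henum : ∀ i : Fin n, ∃ q, ∀ᶠ x in iterFilter W,
      ∀ hi : i.1 < (σ x).toList.length, (σ x).toList[i.1] = h q x := by
    intro i
    obtain ⟨x, hx⟩ := hn.exists
    obtain ⟨d, -⟩ : (σ x).Nonempty := Finset.card_pos.1 (hx ▸ i.pos)
    obtain ⟨q, hq⟩ := hh.surj _ (hσ.comp fun s => s.toList.getD i d)
    refine ⟨q, hq.mono fun x hx hi => ?_⟩
    rwa [List.getD_eq_getElem _ _ hi] at hx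
  choose q hq using henum
  refine ⟨Finset.univ.image q, ?_⟩
  filter_upwards [hn, eventually_all.2 hq] with x hxn hxq k hk
  obtain ⟨m, hm, rfl⟩ := List.getElem_of_mem (Finset.mem_toList.2 hk)
  have hmn : m < n := by rwa [Finset.length_toList, hxn] at hm
  exact ⟨q ⟨m, hmn⟩, Finset.mem_image_of_mem _ (Finset.mem_univ _), (hxq ⟨m, hmn⟩ hm).symm⟩

end EnumeratesUltrapower

end Enumeration

section Slice

variable [Nonempty X]

/-- The function on plays on `K` that arises from a function `G` on plays on `N` and a play `x` on
`E`: a play on `K` is pulled back to `Q` along `q ↦ h q x` and appended to `x`. -/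
noncomputable def slice (e₁ : E → N) (e₂ : Q → N) (h : Q → (E → X) → K) (G : (N → X) → A)
    (x : E → X) : (K → X) → A :=
  fun z => G (join e₁ e₂ x fun q => z (h q x))

theorem dependsOn_join_right (hc : IsConcat e₁ e₂) {G : (N → X) → A} {s : Set N}
    (hG : DependsOn G s) (x : E → X) : DependsOn (fun z => G (join e₁ e₂ x z)) (e₂ ⁻¹' s) := by
  refine fun z z' hz => hG fun n hn => ?_
  rcases hc.cover n with ⟨a, rfl⟩ | ⟨q, rfl⟩
  · rw [join_left hc, join_left hc]
  · rw [join_right hc, join_right hc]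
    exact hz q hn

theorem finitary_slice_apply (hc : IsConcat e₁ e₂) (h : Q → (E → X) → K) {G : (N → X) → A}
    (hG : Finitary G) (x : E → X) : Finitary (slice e₁ e₂ h G x) := by
  obtain ⟨s, hs⟩ := hG
  have hjoin : Finitary fun z => G (join e₁ e₂ x z) :=
    ⟨s.preimage e₂ hc.strictMono_right.injective.injOn, by
      simpa using dependsOn_join_right hc hs x⟩
  exact hjoin.comp_right fun q => h q x

theorem finitary_slice (hc : IsConcat e₁ e₂) {h : Q → (E → X) → K} (hh : ∀ q, Finitary (h q))
    {G : (N → X) → A} (hG : Finitary G) : Finitary (slice e₁ e₂ h G) := by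
  classical
  obtain ⟨s, hs⟩ := hG
  choose t ht using hh
  refine ⟨s.preimage e₁ hc.strictMono_left.injective.injOn ∪
    (s.preimage e₂ hc.strictMono_right.injective.injOn).biUnion t,
    fun x y hxy => funext fun z => hs fun n hn => ?_⟩
  rcases hc.cover n with ⟨a, rfl⟩ | ⟨q, rfl⟩
  · rw [join_left hc, join_left hc]
    exact hxy a (Finset.mem_union_left _ (Finset.mem_preimage.2 hn))
  · rw [join_right hc, join_right hc, ht q fun i hi => hxy i ?_]
    exact Finset.mem_union_right _ (Finset.mem_biUnion.2 ⟨q, Finset.mem_preimage.2 hn, hi⟩)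

variable [LinearOrder K] {U : N → SigmaUltrafilter X} {V : SigmaUltrafilter X} {h : Q → (E → X) → K}

theorem eventually_slice_of [WellFoundedLT Q] (hc : IsConcat e₁ e₂) (hV : ∀ q, U (e₂ q) = V)
    (hh : EnumeratesUltrapower (fun a => U (e₁ a)) h) {P : (N → X) → Prop} (hP : Finitary P)
    (hw : ∀ᶠ w in iterFilter U, P w) :
    ∀ᶠ x in iterFilter fun a => U (e₁ a), ∀ᶠ z in iterFilter fun _ : K => V,
      slice e₁ e₂ h P x z := by
  obtain ⟨s, hs⟩ := hP
  let t : Finset Q := s.preimage e₂ hc.strictMono_right.injective.injOn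
  filter_upwards [hh.eventually_strictMono t, eventually_join hc hw] with x hx hxz
  obtain ⟨R, hR, hRP⟩ := exists_eq_comp_right_of_dependsOn (e := (Subtype.val : t → Q))
    Subtype.val_injective (s := t) (F := fun z => P (join e₁ e₂ x z))
    (by simpa [t] using dependsOn_join_right hc hs x) (by simp)
  have hRt : ∀ᶠ y in iterFilter fun _ : t => V, R y :=
    (hR.eventually_comp_right_iff (e := Subtype.val) (fun _ _ hq => hq) fun q => hV q).1
      (hxz.mono fun z hz => (hRP z).mp hz)
  exact ((tendsto_comp_right_iterFilter hx fun _ => rfl).eventually hRt).mono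
    fun z hz => (hRP _).mpr hz

variable [WellFoundedLT E]

theorem eventually_slice_iff [WellFoundedLT Q] [WellFoundedLT K] (hc : IsConcat e₁ e₂)
    (hV : ∀ q, U (e₂ q) = V)
    (hh : EnumeratesUltrapower (fun a => U (e₁ a)) h) {P : (N → X) → Prop} (hP : Finitary P) :
    (∀ᶠ w in iterFilter U, P w) ↔
    ∀ᶠ x in iterFilter fun a => U (e₁ a), ∀ᶠ z in iterFilter fun _ : K => V,
      slice e₁ e₂ h P x z := by
  refine ⟨eventually_slice_of hc hV hh hP, fun hx =>
    hP.eventually_or_not.resolve_right fun hn => ?_⟩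
  obtain ⟨x, hxP, hxn⟩ := (hx.and (eventually_slice_of hc hV hh (hP.comp Not) hn)).exists
  obtain ⟨z, hzP, hzn⟩ := (hxP.and hxn).exists
  exact hzn hzP

theorem exists_slice_eq (hc : IsConcat e₁ e₂) (hh : EnumeratesUltrapower (fun a => U (e₁ a)) h)
    {P : (E → X) → (K → X) → A} {σ : (E → X) → Finset K} (hP : Finitary P) (hσ : Finitary σ)
    (hPσ : ∀ x, DependsOn (P x) (σ x : Set K)) :
    ∃ H : (N → X) → A, Finitary H ∧
      ∀ᶠ x in iterFilter fun a => U (e₁ a), slice e₁ e₂ h H x = P x := by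
  obtain ⟨t, ht⟩ := hh.exists_finset_cover hσ
  let d : K → X := fun _ => Classical.arbitrary X
  let pos : (E → X) → t → K := fun x q => h q x
  have hpos : Finitary pos := .pi fun q => hh.finitary q
  refine ⟨fun w => P (w ∘ e₁) (Function.extend (pos (w ∘ e₁)) (fun q => w (e₂ q)) d),
    ((hP.prodMk hpos).comp_right e₁).comp₂ (.pi fun q : t => .apply (e₂ q))
      fun p y => p.1 (Function.extend p.2 y d), ?_⟩
  filter_upwards [hh.eventually_strictMono t, ht] with x hx hxt
  funext z
  have hjoin : (join e₁ e₂ x fun q => z (h q x)) ∘ e₁ = x := funext fun a => join_left hc _ _ a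
  simp only [slice, hjoin, join_right hc]
  refine hPσ x fun k hk => ?_
  obtain ⟨q, hq, rfl⟩ := hxt k hk
  exact hx.injective.extend_apply (fun q : t => z (h q x)) d ⟨q, hq⟩

variable [WellFoundedLT Q] [WellFoundedLT K]

theorem exists_collapse_slice_eq (hc : IsConcat e₁ e₂)
    (hh : EnumeratesUltrapower (fun a => U (e₁ a)) h) (hV : ∀ q, U (e₂ q) = V)
    {f : (E → X) → ZFSet.{u}} {G : (N → X) → ZFSet.{u}} (hf : Finitary f) (hG : Finitary G)
    (hfG : ∀ᶠ x in iterFilter fun a => U (e₁ a),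
      f x ∈ collapse (fun _ : K => V) (slice e₁ e₂ h G x)) :
    ∃ H, Finitary H ∧ (∀ᶠ w in iterFilter U, H w ∈ G w) ∧
      ∀ᶠ x in iterFilter fun a => U (e₁ a),
        collapse (fun _ : K => V) (slice e₁ e₂ h H x) = f x := by
  have hrep : ∀ (a : ZFSet.{u}) (g : (K → X) → ZFSet.{u}), ∃ (p : (K → X) → ZFSet.{u})
      (σ : Finset K), DependsOn p (σ : Set K) ∧ (a ∈ collapse (fun _ : K => V) g →
        (∀ᶠ z in iterFilter fun _ : K => V, p z ∈ g z) ∧ collapse (fun _ : K => V) p = a) := by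
    intro a g
    by_cases ha : a ∈ collapse (fun _ : K => V) g
    · obtain ⟨p, ⟨σ, hσ⟩, -, hp, hpa⟩ := mem_collapse.1 ha
      exact ⟨p, σ, hσ, fun _ => ⟨hp, hpa⟩⟩
    · exact ⟨fun _ => ∅, ∅, fun _ _ _ => rfl, fun ha' => absurd ha' ha⟩
  choose p σ hpσ hp using hrep
  have hpair : Finitary fun x => (f x, slice e₁ e₂ h G x) :=
    hf.prodMk (finitary_slice hc hh.finitary hG)
  obtain ⟨H, hH, hHp⟩ := exists_slice_eq hc hh (hpair.comp fun r => p r.1 r.2)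
    (hpair.comp fun r => σ r.1 r.2) fun x => hpσ _ _
  refine ⟨H, hH, (eventually_slice_iff hc hV hh (hH.comp₂ hG (· ∈ ·))).2 ?_, ?_⟩
  · filter_upwards [hHp, hfG] with x hx hxG
    filter_upwards [(hp _ _ hxG).1] with z hz
    exact (congrArg (· ∈ slice e₁ e₂ h G x z) (congrFun hx z)).mpr hz
  · filter_upwards [hHp, hfG] with x hx hxG
    rw [hx]
    exact (hp _ _ hxG).2

variable [WellFoundedLT N]

/-- Iterating `V` along `K` inside the iterated ultrapower along `E` amounts to iterating along `E`
and then along the image `Q` of `K` in that ultrapower. -/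
theorem collapse_slice (hc : IsConcat e₁ e₂) (hV : ∀ q, U (e₂ q) = V)
    (hh : EnumeratesUltrapower (fun a => U (e₁ a)) h) {G : (N → X) → ZFSet.{u}} (hG : Finitary G) :
    collapse U G = collapse (fun a => U (e₁ a)) fun x =>
      collapse (fun _ : K => V) (slice e₁ e₂ h G x) := by
  have hfin : ∀ {G : (N → X) → ZFSet.{u}}, Finitary G →
      Finitary fun x => collapse (fun _ : K => V) (slice e₁ e₂ h G x) :=
    fun hG => (finitary_slice hc hh.finitary hG).comp _
  induction G using (wellFounded_uMem U).induction with
  | _ G ih =>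
    have hmem : ∀ H, UMem U H G → collapse U H ∈ collapse (fun a => U (e₁ a)) fun x =>
        collapse (fun _ : K => V) (slice e₁ e₂ h G x) := by
      intro H hHG
      rw [ih H hHG hHG.1]
      refine collapse_mem_collapse (hfin hG) (hfin hHG.1) ?_
      filter_upwards [eventually_slice_of hc hV hh (hHG.1.comp₂ hG (· ∈ ·)) hHG.2] with x hx
      exact collapse_mem_collapse (finitary_slice_apply hc h hG x)
        (finitary_slice_apply hc h hHG.1 x) hx
    ext y
    constructor <;> intro hy
    · obtain ⟨H, hH, -, hHG, rfl⟩ := mem_collapse.1 hy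
      exact hmem H ⟨hH, hHG⟩
    · obtain ⟨f, hf, -, hfG, rfl⟩ := mem_collapse.1 hy
      obtain ⟨H, hH, hHG, hHf⟩ := exists_collapse_slice_eq hc hh hV hf hG hfG
      rw [← collapse_congr hHf (hfin hH) hf, ← ih H ⟨hH, hHG⟩ hH]
      exact collapse_mem_collapse hG hH hHG

theorem exists_enumeratesUltrapower {W : E → SigmaUltrafilter X} {β : Ordinal.{u}}
    (hβ : embOrd W β = β) :
    ∃ h : β.ToType → (E → X) → β.ToType, EnumeratesUltrapower W h := by
  have hrep : ∀ q : β.ToType, ∃ g : (E → X) → Ordinal.{u}, Finitary g ∧ (∀ x, g x < β) ∧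
      collapseOrd W g = q.toOrd := fun q => exists_collapseOrd_eq_of_lt q.toOrd.2
  choose g hg hgβ hgq using hrep
  refine ⟨fun q x => Ordinal.ToType.mk ⟨g q x, hgβ q x⟩, fun q => ?_, fun q q' hq => ?_,
    fun u hu => ?_⟩
  · obtain ⟨s, hs⟩ := hg q
    exact ⟨s, fun x x' hx => by simp only [hs hx]⟩
  · have hlt : collapseOrd W (g q) < collapseOrd W (g q') := by
      rw [hgq, hgq, Subtype.coe_lt_coe]
      exact (OrderIso.lt_iff_lt _).2 hq
    filter_upwards [(collapseOrd_lt_iff (hg q) (hg q')).1 hlt] with x hx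
    exact (OrderIso.lt_iff_lt _).2 hx
  · have huOrd : Finitary fun x => (u x).toOrd.1 := hu.comp fun t => t.toOrd.1
    have hlt : collapseOrd W (fun x => (u x).toOrd.1) < β :=
      ((collapseOrd_lt_iff huOrd (.const β)).2
        (Eventually.of_forall fun x => (u x).toOrd.2)).trans_eq hβ
    refine ⟨Ordinal.ToType.mk ⟨_, hlt⟩, ?_⟩
    have heq := hgq (Ordinal.ToType.mk ⟨_, hlt⟩)
    simp only [OrderIso.symm_apply_apply] at heq
    filter_upwards [(collapseOrd_eq_iff (hg _) huOrd).1 heq] with x hx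
    simp [hx]

theorem emb_emb_of_embOrd_eq_self {β : Ordinal.{u}} {e₂ : β.ToType → N} (hc : IsConcat e₁ e₂)
    (hβ : embOrd (fun a => U (e₁ a)) β = β) (hV : ∀ q, U (e₂ q) = V) (y : ZFSet.{u}) :
    emb (fun a => U (e₁ a)) (emb (fun _ : β.ToType => V) y) = emb U y := by
  obtain ⟨h, hh⟩ := exists_enumeratesUltrapower hβ
  exact (collapse_slice hc hV hh (.const y)).symm

end Slice

end Composition

/-! ### Measurable cardinals -/

section ToType

variable {o : Ordinal.{u}}

/-- The ordinal below `o` that corresponds to an element of the type of `o`. -/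
noncomputable def rk (i : o.ToType) : Ordinal.{u} := i.toOrd

/-- The element of the type of `o` that corresponds to an ordinal below `o`. -/
noncomputable def elt (a : Ordinal.{u}) (h : a < o) : o.ToType := Ordinal.ToType.mk ⟨a, h⟩

theorem rk_lt (i : o.ToType) : rk i < o := i.toOrd.2

@[simp] theorem rk_elt {a : Ordinal.{u}} (h : a < o) : rk (elt a h) = a := by simp [rk, elt]

theorem rk_strictMono : StrictMono (rk : o.ToType → Ordinal.{u}) := fun _ _ h =>
  Ordinal.ToType.mk.symm.strictMono h

theorem rk_lt_rk {i k : o.ToType} : rk i < rk k ↔ i < k := rk_strictMono.lt_iff_lt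

theorem rk_injective : Function.Injective (rk : o.ToType → Ordinal.{u}) := rk_strictMono.injective

theorem le_of_strictMono_toType {β : Ordinal.{u}} {c : β.ToType → Ordinal.{u}} (hc : StrictMono c)
    (hco : ∀ i, c i < o) : β ≤ o := by
  rw [← Ordinal.type_toType β, ← Ordinal.type_toType o]
  refine Ordinal.type_le_iff'.2 ⟨RelEmbedding.ofMonotone (fun i => elt (c i) (hco i)) ?_⟩
  intro i k hik
  rw [← rk_lt_rk, rk_elt, rk_elt]
  exact hc hik

theorem mk_Iio_ord_lt {c : Cardinal.{u}} (i : c.ord.ToType) : #(Iio i) < c :=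
  (mk_Iio_lt i (by simp)).trans_eq (mk_ord_toType c)

theorem mk_setOf_rk_lt_le (c : Cardinal.{u}) : #{x : o.ToType | rk x < c.ord} ≤ c := by
  refine (mk_le_of_injective (β := c.ord.ToType) (f := fun x => elt (rk x.1) x.2)
    fun x y hxy => Subtype.ext (rk_injective ?_)).trans (mk_ord_toType c).le
  simpa using congrArg rk hxy

end ToType

section Nonprincipal

variable {δ : Cardinal.{u}} {α : Type u}

theorem compl_mem_of_mk_lt {V : Ultrafilter α} [CardinalInterFilter (V : Filter α) δ]
    (hV : ∀ a, {a} ∉ V) {s : Set α} (hs : #s < δ) : sᶜ ∈ V := by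
  have h : (⋂ a ∈ s, ({a}ᶜ : Set α)) ∈ (V : Filter α) :=
    (cardinal_bInter_mem hs).2 fun a _ => Ultrafilter.compl_mem_iff_notMem.2 (hV a)
  refine mem_of_superset h fun x hx hxs => ?_
  exact mem_iInter₂.1 hx x hxs rfl

theorem two_power_lt_mk_of_nonprincipal {V : Ultrafilter α} [CardinalInterFilter (V : Filter α) δ]
    (hV : ∀ a, {a} ∉ V) {ν : Cardinal.{u}} (hν : ν < δ) : 2 ^ ν < #α := by
  by_contra! hle
  obtain ⟨f⟩ : Nonempty (α ↪ Set ν.out) := by rwa [← Cardinal.le_def, mk_set, mk_out]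
  have hdecide : ∀ᶠ i in (V : Filter α), ∀ a : ν.out,
      (a ∈ f i ↔ ∀ᶠ k in (V : Filter α), a ∈ f k) := by
    refine (eventually_cardinal_forall (by rwa [mk_out])).2 fun a => ?_
    by_cases ha : ∀ᶠ k in (V : Filter α), a ∈ f k
    · exact ha.mono fun i hi => iff_of_true hi ha
    · exact (Ultrafilter.eventually_not.2 ha).mono fun i hi => iff_of_false hi ha
  obtain ⟨i₀, hi₀⟩ := hdecide.exists
  exact hV i₀ (hdecide.mono fun i hi => f.injective (Set.ext fun a => (hi a).trans (hi₀ a).symm))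

theorem le_cof_ord_of_nonprincipal (hδ : ℵ₀ ≤ δ) {V : Ultrafilter δ.ord.ToType}
    [CardinalInterFilter (V : Filter δ.ord.ToType) δ] (hV : ∀ a, {a} ∉ V) : δ ≤ δ.ord.cof := by
  by_contra! hcof
  obtain ⟨s, hs, hsc⟩ := Order.exists_cof_eq (α := δ.ord.ToType)
  rw [Ordinal.cof_toType] at hsc
  have hIic : ∀ b : δ.ord.ToType, #(Iic b) < δ := fun b => by
    rw [← Iio_insert]
    exact mk_insert_le.trans_lt
      (add_lt_of_lt hδ (mk_Iio_ord_lt b) (one_lt_aleph0.trans_le hδ))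
  have hmem : (⋂ b ∈ s, (Iic b)ᶜ) ∈ (V : Filter δ.ord.ToType) :=
    (cardinal_bInter_mem (hsc.trans_lt hcof)).2 fun b _ => compl_mem_of_mk_lt hV (hIic b)
  obtain ⟨x, hx⟩ := V.nonempty_of_mem hmem
  obtain ⟨b, hb, hxb⟩ := hs x
  exact mem_iInter₂.1 hx b hb hxb

theorem isInaccessible_of_isMeasurableCardinal (h : PerfectSubset.IsMeasurableCardinal δ) :
    IsInaccessible δ := by
  obtain ⟨hδ, V, hVδ, hV⟩ := h
  exact ⟨hδ, le_cof_ord_of_nonprincipal hδ.le hV, fun ν hν =>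
    (two_power_lt_mk_of_nonprincipal hV hν).trans_eq (mk_ord_toType δ)⟩

end Nonprincipal

/-- A measurable cardinal `card` below `κ`, together with a measure on it. The measure is
transferred to `κ`, so that different cardinals can be used in one iteration. -/
structure MeasureBelow (κ : Cardinal.{u}) where
  card : Cardinal.{u}
  ult : SigmaUltrafilter κ.ord.ToType
  inaccessible : IsInaccessible card
  lt : card < κ
  complete : CardinalInterFilter (ult.1 : Filter κ.ord.ToType) card
  large : {x | rk x < card.ord} ∈ ult.1
  unbounded : ∀ θ < card.ord, {x | θ < rk x} ∈ ult.1

theorem exists_measureBelow {κ δ : Cardinal.{u}} (h : PerfectSubset.IsMeasurableCardinal δ)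
    (hδκ : δ < κ) : ∃ M : MeasureBelow κ, M.card = δ := by
  have hinacc := isInaccessible_of_isMeasurableCardinal h
  obtain ⟨hδ, V, hVδ, hV⟩ := h
  let f : δ.ord.ToType → κ.ord.ToType := fun i => elt (rk i) ((rk_lt i).trans (ord_lt_ord.2 hδκ))
  have hf : ∀ i, rk (f i) = rk i := fun i => rk_elt _
  have hc : CardinalInterFilter ((V.map f : Ultrafilter κ.ord.ToType) : Filter κ.ord.ToType) δ := by
    rw [Ultrafilter.coe_map]
    infer_instance
  refine ⟨⟨δ, ⟨V.map f, @CardinalInterFilter.toCountableInterFilter _ _ _ hc hδ⟩, hinacc, hδκ, hc,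
    ?_, fun θ hθ => ?_⟩, rfl⟩
  · refine Ultrafilter.mem_map.2 (Filter.univ_mem' fun i => ?_)
    simpa only [mem_preimage, mem_ofPred_eq, hf] using rk_lt i
  · have hlim : θ + 1 < δ.ord := (isSuccLimit_ord hδ.le).add_one_lt hθ
    refine Ultrafilter.mem_map.2 (mem_of_superset
      (compl_mem_of_mk_lt hV (mk_Iio_ord_lt (elt (θ + 1) hlim))) fun i hi => ?_)
    have hle : θ + 1 ≤ rk i := by
      simpa only [mem_compl_iff, mem_Iio, ← rk_lt_rk, rk_elt, not_lt] using hi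
    simpa only [mem_preimage, mem_ofPred_eq, hf] using Order.add_one_le_iff.1 hle

theorem MeasureBelow.complete_of_le {κ c : Cardinal.{u}} (M : MeasureBelow κ) (h : c ≤ M.card) :
    CardinalInterFilter (M.ult.1 : Filter κ.ord.ToType) c :=
  @CardinalInterFilter.of_cardinalInterFilter_of_le _ _ _ M.complete _ h

theorem MeasureBelow.setOf_rk_lt_mem {κ c : Cardinal.{u}} (M : MeasureBelow κ) (h : M.card ≤ c) :
    {x | rk x < c.ord} ∈ M.ult.1 :=
  mem_of_superset M.large fun x (hx : rk x < _) => hx.trans_le (ord_le_ord.2 h)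

/-- The measurable cardinals of the family are unbounded in `κ`. -/
def IsCofinalFamily {κ : Cardinal.{u}} {A : Type*} (M : A → MeasureBelow κ) : Prop :=
  ∀ ν < κ, ∃ i, ν < (M i).card

theorem exists_isCofinalFamily {κ : Cardinal.{u}} (hκ : PerfectSubset.IsLimitOfMeasurables κ) :
    ∃ M : κ.ord.ToType → MeasureBelow κ, IsCofinalFamily M := by
  have hM : ∀ i : κ.ord.ToType, ∃ M : MeasureBelow κ, (rk i).card < M.card := fun i => by
    obtain ⟨δ, hiδ, hδκ, hδ⟩ := hκ.2 _ (lt_ord.1 (rk_lt i))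
    obtain ⟨M, rfl⟩ := exists_measureBelow hδ hδκ
    exact ⟨M, hiδ⟩
  choose M hM using hM
  refine ⟨M, fun ν hν => ⟨elt ν.ord (ord_lt_ord.2 hν), ?_⟩⟩
  simpa using hM (elt ν.ord (ord_lt_ord.2 hν))

section IsCofinalFamily

variable {κ : Cardinal.{u}} {A : Type*} {M : A → MeasureBelow κ}

theorem IsCofinalFamily.isStrongPrelimit (hM : IsCofinalFamily M) : IsStrongPrelimit κ :=
  fun ν hν => by
    obtain ⟨i, hi⟩ := hM ν hν
    exact ((M i).inaccessible.isStrongPrelimit hi).trans (M i).lt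

theorem IsCofinalFamily.aleph0_lt [Nonempty κ.ord.ToType] (hM : IsCofinalFamily M) : ℵ₀ < κ := by
  obtain ⟨i, -⟩ := hM 0 (by rw [pos_iff_ne_zero, ← mk_ord_toType κ]; exact mk_ne_zero _)
  exact (M i).inaccessible.aleph0_lt.trans (M i).lt

end IsCofinalFamily

/-! ### Agreement of images below an ordinal -/

/-- `y` and `z` have the same ordinals below `η` as elements. -/
def AgreeBelow (η : Ordinal.{u}) (y z : ZFSet.{u}) : Prop :=
  ∀ θ < η, (θ.toZFSet ∈ y ↔ θ.toZFSet ∈ z)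

section AgreeBelow

variable {η θ : Ordinal.{u}} {x y z : ZFSet.{u}}

theorem AgreeBelow.symm (h : AgreeBelow η y z) : AgreeBelow η z y := fun θ hθ => (h θ hθ).symm

theorem AgreeBelow.trans (hxy : AgreeBelow η x y) (hyz : AgreeBelow η y z) : AgreeBelow η x z :=
  fun θ hθ => (hxy θ hθ).trans (hyz θ hθ)

theorem AgreeBelow.mono (hηθ : η ≤ θ) (h : AgreeBelow θ y z) : AgreeBelow η y z :=
  fun ξ hξ => h ξ (hξ.trans_le hηθ)

theorem inter_toZFSet_eq_iff : y ∩ η.toZFSet = z ∩ η.toZFSet ↔ AgreeBelow η y z := by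
  have hmem : ∀ θ < η, ∀ x : ZFSet.{u}, θ.toZFSet ∈ x ∩ η.toZFSet ↔ θ.toZFSet ∈ x :=
    fun θ hθ x => by
      rw [ZFSet.mem_inter, Ordinal.toZFSet_mem_toZFSet_iff]
      exact and_iff_left hθ
  constructor
  · intro h θ hθ
    rw [← hmem θ hθ y, h, hmem θ hθ z]
  · intro h
    ext w
    simp only [ZFSet.mem_inter]
    refine and_congr_left fun hw => ?_
    obtain ⟨θ, hθ, rfl⟩ := Ordinal.mem_toZFSet_iff.1 hw
    exact h θ hθ

theorem AgreeBelow.eq (h : AgreeBelow η y z) (hy : y ⊆ η.toZFSet) (hz : z ⊆ η.toZFSet) : y = z := by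
  have hinter : ∀ x ⊆ η.toZFSet, x ∩ η.toZFSet = x := fun x hx => ZFSet.ext fun w => by
    simpa only [ZFSet.mem_inter, and_iff_left_iff_imp] using @hx w
  rw [← hinter y hy, ← hinter z hz]
  exact inter_toZFSet_eq_iff.2 h

variable {L X : Type u} [LinearOrder L] [WellFoundedLT L] [Nonempty X] {U : L → SigmaUltrafilter X}

theorem agreeBelow_emb_iff : AgreeBelow (embOrd U η) (emb U y) (emb U z) ↔ AgreeBelow η y z := by
  refine ⟨fun h θ hθ => ?_, fun h θ hθ => ?_⟩
  · have hemb : ∀ x, (embOrd U θ).toZFSet ∈ emb U x ↔ θ.toZFSet ∈ x := fun x =>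
      (toZFSet_collapseOrd_mem_emb (.const θ)).trans eventually_const
    rw [← hemb, ← hemb]
    exact h _ (embOrd_strictMono hθ)
  · obtain ⟨g, hg, hgη, rfl⟩ := exists_collapseOrd_eq_of_lt_embOrd hθ
    rw [toZFSet_collapseOrd_mem_emb hg, toZFSet_collapseOrd_mem_emb hg]
    exact eventually_congr (Eventually.of_forall fun x => h _ (hgη x))

theorem agreeBelow_emb_iff_of_embOrd_eq_self (hη : embOrd U η = η) :
    AgreeBelow η (emb U y) (emb U z) ↔ AgreeBelow η y z := by
  conv_lhs => rw [← hη]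
  exact agreeBelow_emb_iff

end AgreeBelow

/-! ### Iterating a single measure -/

section StrongLimit

variable {L X : Type u} [LinearOrder L] [WellFoundedLT L] [Nonempty X] {U : L → SigmaUltrafilter X}
  {δ : Cardinal.{u}} {Y : Set X}

theorem embOrd_lt_ord_of_isStrongPrelimit (hδ : IsStrongPrelimit δ) (hδ₀ : ℵ₀ < δ) (hL : #L < δ)
    (hY : ∀ i, Y ∈ (U i).1) (hYδ : #Y < δ) {θ : Ordinal.{u}} (hθ : θ < δ.ord) :
    embOrd U θ < δ.ord := by
  obtain ⟨ν, hν, hν₀, hLν, hYν, hθν⟩ : ∃ ν < δ, ℵ₀ ≤ ν ∧ #L ≤ ν ∧ #Y ≤ ν ∧ θ.card ≤ ν :=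
    ⟨max (max ℵ₀ #L) (max #Y θ.card), max_lt (max_lt hδ₀ hL) (max_lt hYδ (lt_ord.1 hθ)),
      by simp only [le_max_iff, le_refl, true_or, or_true, and_self]⟩
  have hpow : ν ≤ 2 ^ ν := (cantor ν).le
  exact lt_ord.2
    ((card_embOrd_le hν₀ (hLν.trans hpow) hY hYν (hθν.trans hpow)).trans_lt (hδ hν))

theorem embOrd_ord_of_isInaccessible (hδ : IsInaccessible δ) (hL : #L < δ)
    (hY : ∀ i, Y ∈ (U i).1) (hYδ : #Y < δ) : embOrd U δ.ord = δ.ord := by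
  refine embOrd_eq_self_of_bounded (fun g ⟨s, hs⟩ hg => ?_) fun θ hθ =>
    embOrd_lt_ord_of_isStrongPrelimit hδ.isStrongPrelimit hδ.aleph0_lt hL hY hYδ hθ
  refine exists_eventually_le_of_concentrate hs (fun i _ => hY i) ?_ hg
  rw [hδ.isRegular.cof_ord]
  exact max_lt hYδ hδ.aleph0_lt

end StrongLimit

section BlockLength

variable {μ ν T : Cardinal.{u}}

/-- The lengths of the iterations that are used for coding. Such a length is fixed by every
shorter iteration of measures on `ν`, so that the shorter iteration is absorbed by the longer
one. -/
noncomputable def blockLength (ν : Cardinal.{u}) : Ordinal.{u} :=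
  (Order.succ ((2 : Cardinal.{u}) ^ ν)).ord

theorem mk_blockLength_toType (ν : Cardinal.{u}) :
    #(blockLength ν).ToType = Order.succ ((2 : Cardinal.{u}) ^ ν) := mk_ord_toType _

theorem mk_blockLength_toType_lt (hT : IsInaccessible T) (hν : ν < T) :
    #(blockLength ν).ToType < T := by
  rw [mk_blockLength_toType]
  exact hT.isSuccLimit.succ_lt (hT.isStrongPrelimit hν)

theorem lt_of_two_power_lt (h : (2 : Cardinal.{u}) ^ μ < 2 ^ ν) : μ < ν :=
  lt_of_not_ge fun hle => h.not_ge (power_le_power_left two_ne_zero hle)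

theorem exists_injective_two_power (hT : IsInaccessible T) (hν : ν < T) {I : Type u}
    (hI : #I < T) : ∃ o : I → Cardinal.{u}, (∀ i, 2 ^ ν ≤ o i ∧ o i < T) ∧
      Function.Injective fun i => (2 : Cardinal.{u}) ^ o i := by
  obtain ⟨f⟩ : Nonempty (I ↪ T.ord.ToType) := by
    rw [← Cardinal.le_def, mk_ord_toType]
    exact hI.le
  refine ⟨fun i => ℶ_ (ν.ord + 1 + rk (f i)), fun i => ⟨?_, ?_⟩, fun i k hik => ?_⟩
  · calc (2 : Cardinal.{u}) ^ ν ≤ 2 ^ ℶ_ ν.ord := power_le_power_left two_ne_zero (le_beth_ord ν)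
      _ = ℶ_ (ν.ord + 1) := (beth_add_one _).symm
      _ ≤ ℶ_ (ν.ord + 1 + rk (f i)) := beth_le_beth.2 le_self_add
  · calc ℶ_ (ν.ord + 1 + rk (f i)) < ℶ_ T.ord := beth_lt_beth.2
          (Ordinal.isPrincipal_add_ord hT.aleph0_lt.le
            ((isSuccLimit_ord hT.aleph0_lt.le).add_one_lt (ord_lt_ord.2 hν)) (rk_lt _))
      _ = T := hT.beth_ord
  · simpa only [← beth_add_one, beth_strictMono.injective.eq_iff, Order.add_one_inj,
      add_right_inj, rk_injective.eq_iff, f.injective.eq_iff] using hik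

theorem isConcat_toType {γ β : Ordinal.{u}} (hγ : γ < β) (hβ : ∀ θ < β, γ + θ < β) :
    IsConcat (N := β.ToType) (fun i : γ.ToType => elt (rk i) ((rk_lt i).trans hγ))
      (fun i : β.ToType => elt (γ + rk i) (hβ _ (rk_lt i))) where
  strictMono_left i k h := by
    rw [← rk_lt_rk, rk_elt, rk_elt]
    exact rk_lt_rk.2 h
  strictMono_right i k h := by
    rw [← rk_lt_rk, rk_elt, rk_elt, add_lt_add_iff_left]
    exact rk_lt_rk.2 h
  lt i k := by
    rw [← rk_lt_rk, rk_elt, rk_elt]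
    exact (rk_lt i).trans_le le_self_add
  cover n := by
    rcases lt_or_ge (rk n) γ with h | h
    · exact .inl ⟨elt _ h, rk_injective (by rw [rk_elt, rk_elt])⟩
    · refine .inr ⟨elt (rk n - γ) ((Ordinal.sub_le_self _ _).trans_lt (rk_lt n)),
        rk_injective ?_⟩
      rw [rk_elt, rk_elt, Ordinal.add_sub_cancel_of_le h]

end BlockLength

namespace MeasureBelow

variable {κ ν ν' T : Cardinal.{u}} [Nonempty κ.ord.ToType] (M : MeasureBelow κ) {y z : ZFSet.{u}}

/-- The elementary embedding that belongs to the iteration of length `blockLength ν` of the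
measure. -/
noncomputable def block (ν : Cardinal.{u}) (y : ZFSet.{u}) : ZFSet.{u} :=
  emb (fun _ : (blockLength ν).ToType => M.ult) y

/-- The critical points of the iteration, represented by the coordinate functions, increase. -/
theorem le_embOrd_const (β : Ordinal.{u}) :
    β ≤ embOrd (fun _ : β.ToType => M.ult) M.card.ord := by
  have hfin : ∀ i : β.ToType, Finitary fun x : β.ToType → κ.ord.ToType => rk (x i) :=
    fun i => (Finitary.apply i).comp rk
  refine le_of_strictMono_toType
    (c := fun i => collapseOrd (fun _ : β.ToType => M.ult) fun x => rk (x i))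
    (fun i k hik => (collapseOrd_lt_iff (hfin i) (hfin k)).2 ?_) fun i =>
    (collapseOrd_lt_iff (hfin i) (.const _)).2
      (eventually_apply_mem (Y := {x | rk x < M.card.ord}) M.large)
  refine eventually_of_eventually_update (a := k) (P := fun x => rk (x i) < rk (x k))
    (fun x y hxy => ?_) ?_
  · simp only [hxy i hik.le, hxy k self_mem_Iic]
  · filter_upwards [eventually_apply_mem (U := fun _ : β.ToType => M.ult) (i := i) M.large]
      with x hx
    filter_upwards [M.unbounded _ hx] with z hz
    simpa only [Function.update_of_ne hik.ne, Function.update_self] using hz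

theorem block_block (hν : M.card ≤ ν) (h : (2 : Cardinal.{u}) ^ ν < 2 ^ ν') (y : ZFSet.{u}) :
    M.block ν (M.block ν' y) = M.block ν' y := by
  have hν' : ν ≤ ν' := (lt_of_two_power_lt h).le
  have hν'₀ : ℵ₀ ≤ ν' := M.inaccessible.aleph0_lt.le.trans (hν.trans hν')
  have hlt : blockLength ν < blockLength ν' := ord_lt_ord.2 (Order.succ_lt_succ h)
  have hconcat := isConcat_toType hlt fun θ hθ => Ordinal.isPrincipal_add_ord
    (hν'₀.trans ((cantor ν').le.trans (Order.le_succ _))) hlt hθ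
  have hfix : embOrd (fun _ : (blockLength ν).ToType => M.ult) (blockLength ν') =
      blockLength ν' := by
    refine embOrd_ord_succ_two_power hν'₀ ?_ (Y := {x | rk x < M.card.ord}) (fun _ => M.large)
      ((mk_setOf_rk_lt_le M.card).trans (hν.trans hν'))
    rw [mk_blockLength_toType]
    exact Order.succ_le_of_lt h
  exact emb_emb_of_embOrd_eq_self (U := fun _ => M.ult) hconcat hfix (fun _ => rfl) y

theorem agreeBelow_block_iff (hT : IsInaccessible T) (hM : M.card < T) (hν : ν < T) :
    AgreeBelow T.ord (M.block ν y) (M.block ν z) ↔ AgreeBelow T.ord y z :=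
  agreeBelow_emb_iff_of_embOrd_eq_self <| embOrd_ord_of_isInaccessible hT
    (mk_blockLength_toType_lt hT hν) (fun _ => M.large) ((mk_setOf_rk_lt_le _).trans_lt hM)

theorem agreeBelow_block_self_of_two_power_lt (hT : IsInaccessible T) (hν : M.card ≤ ν)
    (h : (2 : Cardinal.{u}) ^ ν < 2 ^ ν') (hνT : ν < T)
    (hy : AgreeBelow T.ord (M.block ν' y) y) : AgreeBelow T.ord (M.block ν y) y := by
  have hblock := (M.agreeBelow_block_iff hT (hν.trans_lt hνT) hνT).2 hy
  rw [M.block_block hν h] at hblock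
  exact hblock.symm.trans hy

theorem agreeBelow_block_self_of_block (hT : IsInaccessible T) (hν : M.card ≤ ν)
    (h : (2 : Cardinal.{u}) ^ ν < 2 ^ ν') (hνT : ν < T)
    (hy : AgreeBelow T.ord (M.block ν y) (M.block ν' y)) : AgreeBelow T.ord (M.block ν y) y := by
  have hiff := fun x z => M.agreeBelow_block_iff (y := x) (z := z) hT (hν.trans_lt hνT) hνT
  have hblock := (hiff _ _).2 hy
  rw [M.block_block hν h] at hblock
  exact (hiff _ _).1 (hblock.trans hy.symm)

/-- Some iteration of the measure moves `y` below `κ`. -/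
def Moves (y : ZFSet.{u}) : Prop :=
  ∃ ν, M.card ≤ ν ∧ ν < κ ∧ ¬ AgreeBelow κ.ord (M.block ν y) y

theorem exists_lengths {A : Type*} {N : A → MeasureBelow κ} (hN : IsCofinalFamily N)
    (hy : M.Moves y) {I : Type u} (hI : #I < κ) :
    ∃ (o : I → Cardinal.{u}) (T : Cardinal.{u}), T < κ ∧ M.card < T ∧ IsInaccessible T ∧
      (∀ i, M.card ≤ o i ∧ o i < T) ∧
      ∀ i k, AgreeBelow T.ord (M.block (o i) y) (M.block (o k) y) → i = k := by
  obtain ⟨ν, hMν, hνκ, hmoves⟩ := hy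
  obtain ⟨θ, hθ, hne⟩ : ∃ θ < κ.ord, ¬ (θ.toZFSet ∈ M.block ν y ↔ θ.toZFSet ∈ y) := by
    simpa only [AgreeBelow, not_forall, exists_prop] using hmoves
  obtain ⟨a, ha⟩ := hN (max (max ν θ.card) #I) (max_lt (max_lt hνκ (lt_ord.1 hθ)) hI)
  obtain ⟨⟨hνT, hθT⟩, hIT⟩ := by simpa only [max_lt_iff] using ha
  have hT := (N a).inaccessible
  obtain ⟨o, ho, hinj⟩ := exists_injective_two_power hT hνT hIT
  have hνo : ∀ i, ν ≤ o i := fun i => (cantor ν).le.trans (ho i).1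
  have hdiff : ∀ i k, (2 : Cardinal.{u}) ^ o i < 2 ^ o k →
      ¬ AgreeBelow (N a).card.ord (M.block (o i) y) (M.block (o k) y) := fun i k hik hagree =>
    hne (M.agreeBelow_block_self_of_two_power_lt hT hMν ((ho i).1.trans_lt (cantor _)) hνT
      (M.agreeBelow_block_self_of_block hT (hMν.trans (hνo i)) hik (ho i).2 hagree)
      θ (lt_ord.2 hθT))
  refine ⟨o, (N a).card, (N a).lt, hMν.trans_lt hνT, hT,
    fun i => ⟨hMν.trans (hνo i), (ho i).2⟩, fun i k hagree => hinj (le_antisymm ?_ ?_)⟩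
  · exact le_of_not_gt fun hki => hdiff k i hki hagree.symm
  · exact le_of_not_gt fun hik => hdiff i k hik hagree

/-- Every ordinal below `κ` is represented by a function into `M.card` in some iteration. -/
theorem eq_of_not_moves (hy : y ⊆ κ.ord.toZFSet) (hz : z ⊆ κ.ord.toZFSet) (hyM : ¬ M.Moves y)
    (hzM : ¬ M.Moves z) (h : AgreeBelow M.card.ord y z) : y = z := by
  refine AgreeBelow.eq (fun θ hθ => ?_) hy hz
  set ν := max M.card θ.card
  have hfix : ∀ x, ¬ M.Moves x → AgreeBelow κ.ord (M.block ν x) x := fun x hx =>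
    not_not.1 fun hne => hx ⟨ν, le_max_left _ _, max_lt M.lt (lt_ord.1 hθ), hne⟩
  have hθν : θ < embOrd (fun _ : (blockLength ν).ToType => M.ult) M.card.ord :=
    (lt_ord.2 ((le_max_right _ _).trans_lt ((cantor ν).trans (Order.lt_succ _)))).trans_le
      (M.le_embOrd_const (blockLength ν))
  rw [← hfix y hyM θ hθ, ← hfix z hzM θ hθ]
  exact agreeBelow_emb_iff.2 h θ hθν

theorem mk_not_moves_le {ι : Type u} {y : ι → ZFSet.{u}} (hy : Function.Injective y)
    (hsub : ∀ i, y i ⊆ κ.ord.toZFSet) : #{i | ¬ M.Moves (y i)} ≤ 2 ^ M.card := by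
  rw [← mk_ord_toType M.card, ← mk_set]
  refine mk_le_of_injective (f := fun i => {a : M.card.ord.ToType | (rk a).toZFSet ∈ y i})
    fun i k hik => Subtype.ext (hy (M.eq_of_not_moves (hsub i) (hsub k) i.2 k.2 fun θ hθ => ?_))
  simpa only [mem_ofPred_eq, rk_elt] using Set.ext_iff.1 hik (elt θ hθ)

end MeasureBelow

theorem exists_forall_moves {κ : Cardinal.{u}} [Nonempty κ.ord.ToType]
    {M : κ.ord.ToType → MeasureBelow κ} (hM : IsCofinalFamily M) {D : ZFSet.{u}}
    (hD : D ⊆ ZFSet.powerset κ.ord.toZFSet) (hcard : κ < D.card) :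
    ∃ y ∈ D, ∀ i, (M i).Moves y := by
  by_contra! hcon
  let y : Shrink D → ZFSet.{u} := fun d => (equivShrink D).symm d
  have hy : Function.Injective y :=
    Subtype.val_injective.comp (equivShrink D).symm.injective
  have hyD : ∀ d, y d ∈ D := fun d => ((equivShrink D).symm d).2
  have hcover : (⋃ i, {d | ¬ (M i).Moves (y d)}) = Set.univ :=
    eq_univ_of_forall fun d => mem_iUnion.2 (hcon _ (hyD d))
  refine hcard.not_ge ?_
  calc D.card = #(⋃ i, {d | ¬ (M i).Moves (y d)}) := by rw [hcover, mk_univ]; rfl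
    _ ≤ Cardinal.sum fun i => #{d | ¬ (M i).Moves (y d)} := mk_iUnion_le_sum_mk
    _ ≤ Cardinal.sum fun _ : κ.ord.ToType => κ := sum_le_sum _ _ fun i =>
        ((M i).mk_not_moves_le hy fun d => ZFSet.mem_powerset.1 (hD (hyD d))).trans
          (hM.isStrongPrelimit (M i).lt).le
    _ = κ := by rw [sum_const', mk_ord_toType, mul_eq_self hM.aleph0_lt.le]

/-! ### Iterating a sequence of measures -/

section Steps

variable {Λ : Type u}

/-- The index order of an iteration that uses the `ξ`-th of a sequence of measures `w ξ` many
times. -/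
def Steps (w : Λ → Ordinal.{u}) : Type u := Σ ξ, (w ξ).ToType

namespace Steps

variable {w w' : Λ → Ordinal.{u}}

/-- The position of the measure that is used at a step. -/
def pos (p : Steps w) : Λ := p.1

/-- The order type of the previous uses of the measure that is used at a step. -/
noncomputable def idx (p : Steps w) : Ordinal.{u} := rk p.2

/-- The step with given position and given order type of previous uses. -/
noncomputable def mk (ξ : Λ) (a : Ordinal.{u}) (h : a < w ξ) : Steps w := ⟨ξ, elt a h⟩

@[simp] theorem pos_mk {ξ : Λ} {a : Ordinal.{u}} (h : a < w ξ) : (mk ξ a h).pos = ξ := rfl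

@[simp] theorem idx_mk {ξ : Λ} {a : Ordinal.{u}} (h : a < w ξ) : (mk ξ a h).idx = a := rk_elt h

theorem idx_lt (p : Steps w) : p.idx < w p.pos := rk_lt p.2

theorem ext {p q : Steps w} (hpos : p.pos = q.pos) (hidx : p.idx = q.idx) : p = q := by
  obtain ⟨ξ, a⟩ := p
  obtain ⟨ζ, b⟩ := q
  obtain rfl : ξ = ζ := hpos
  exact congrArg (Sigma.mk ξ) (rk_injective hidx)

noncomputable instance [LinearOrder Λ] : LinearOrder (Steps w) :=
  LinearOrder.lift' (fun p => toLex (p.pos, p.idx)) fun _ _ h =>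
    ext (congrArg (fun a => (ofLex a).1) h) (congrArg (fun a => (ofLex a).2) h)

theorem lt_iff [LinearOrder Λ] {p q : Steps w} :
    p < q ↔ p.pos < q.pos ∨ p.pos = q.pos ∧ p.idx < q.idx :=
  Prod.Lex.lt_iff

instance [LinearOrder Λ] [WellFoundedLT Λ] : WellFoundedLT (Steps w) :=
  StrictMono.wellFoundedLT (f := fun p : Steps w => toLex (p.pos, p.idx)) fun _ _ h => h

/-- The inclusion between two iterations of the same measures, one of which uses them less
often. -/
noncomputable def incl (h : w ≤ w') (p : Steps w) : Steps w' :=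
  mk p.pos p.idx (p.idx_lt.trans_le (h p.pos))

theorem incl_strictMono [LinearOrder Λ] (h : w ≤ w') : StrictMono (incl h) := fun p q hpq =>
  lt_iff.2 (by simpa only [incl, pos_mk, idx_mk] using lt_iff.1 hpq)

theorem mem_range_incl {h : w ≤ w'} {p : Steps w'} (hp : w p.pos = w' p.pos) :
    p ∈ range (incl h) :=
  ⟨mk p.pos p.idx (p.idx_lt.trans_eq hp.symm), ext rfl (by simp only [incl, idx_mk])⟩

theorem pos_mem_of_indicator {S : Set Λ} (p : Steps (S.indicator w)) : p.pos ∈ S := by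
  by_contra h
  exact not_lt_zero (p.idx_lt.trans_eq (indicator_of_notMem h w))

theorem mk_indicator_le {S : Set Λ} {t : Cardinal.{u}} (h : ∀ ξ ∈ S, w ξ ≤ t.ord) :
    #(Steps (S.indicator w)) ≤ #S * t := by
  have hidx : ∀ p : Steps (S.indicator w), p.idx < t.ord := fun p =>
    p.idx_lt.trans_le ((indicator_of_mem p.pos_mem_of_indicator w).trans_le
      (h _ p.pos_mem_of_indicator))
  rw [← mk_ord_toType t, mul_def]
  refine mk_le_of_injective
    (f := fun p : Steps (S.indicator w) => (⟨p.pos, p.pos_mem_of_indicator⟩, elt _ (hidx p)))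
    fun p q hpq => ?_
  rw [Prod.mk.injEq] at hpq
  exact ext (congrArg Subtype.val hpq.1) (by simpa only [rk_elt] using congrArg rk hpq.2)

theorem isConcat_indicator [LinearOrder Λ] (w : Λ → Ordinal.{u}) (ξ : Λ) :
    IsConcat
      (incl (indicator_le_indicator_of_subset Iio_subset_Iic_self fun _ => zero_le) :
        Steps ((Iio ξ).indicator w) → Steps ((Iic ξ).indicator w))
      (fun b : (w ξ).ToType =>
        mk ξ (rk b) ((rk_lt b).trans_eq (indicator_of_mem self_mem_Iic w).symm)) where
  strictMono_left := incl_strictMono _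
  strictMono_right b b' h := lt_iff.2 (.inr ⟨rfl, by simpa only [idx_mk] using rk_strictMono h⟩)
  lt p b := lt_iff.2 (.inl p.pos_mem_of_indicator)
  cover p := by
    rcases p.pos_mem_of_indicator.lt_or_eq with h | h
    · exact .inl (mem_range_incl
        ((indicator_of_mem (mem_Iio.2 h) w).trans (indicator_of_mem (mem_Iic.2 h.le) w).symm))
    · have hlt : p.idx < w ξ := by
        simpa only [h, indicator_of_mem self_mem_Iic] using p.idx_lt
      exact .inr ⟨elt p.idx hlt, ext h.symm (by simp only [idx_mk, rk_elt])⟩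

end Steps

variable {κ : Cardinal.{u}} {M : Λ → MeasureBelow κ} {w : Λ → Ordinal.{u}}

/-- The ultrafilters of the iteration that uses the measure `M ξ` at every step of position
`ξ`. -/
def ults (M : Λ → MeasureBelow κ) (w : Λ → Ordinal.{u}) :
    Steps w → SigmaUltrafilter κ.ord.ToType :=
  fun p => (M p.pos).ult

theorem isEndExtension_indicator [LinearOrder Λ] {S : Set Λ} (hS : IsLowerSet S) {c : Cardinal.{u}}
    (hc : ∀ ξ ∉ S, c ≤ (M ξ).card) :
    IsEndExtension c (ults M (S.indicator w)) (ults M w)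
      (Steps.incl (indicator_le_self' fun _ _ => zero_le)) := by
  have hpos : ∀ p ∉ range (Steps.incl (w := S.indicator w) (w' := w)
      (indicator_le_self' fun _ _ => zero_le)), p.pos ∉ S := fun p hp hpS =>
    hp (Steps.mem_range_incl (indicator_of_mem hpS w))
  refine ⟨Steps.incl_strictMono _, fun _ => rfl, fun p hp q => ?_, fun p hp =>
    (M p.pos).complete_of_le (hc _ (hpos p hp))⟩
  exact Steps.lt_iff.2 (.inl (lt_of_not_ge fun hle =>
    hpos p hp (hS hle q.pos_mem_of_indicator)))

end Steps

/-! ### Towers of measures -/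

theorem exists_forall_of_forall_exists_lt {Λ : Type*} [LinearOrder Λ] [WellFoundedLT Λ]
    {A : Type*} {P : ∀ ξ : Λ, (Iio ξ → A) → A → Prop} (h : ∀ ξ g, ∃ a, P ξ g a) :
    ∃ F : Λ → A, ∀ ξ, P ξ (fun ζ => F ζ) (F ξ) := by
  choose G hG using h
  let F : Λ → A := (wellFounded_lt (α := Λ)).fix fun ξ g => G ξ fun ζ => g ζ ζ.2
  have hF : ∀ ξ, F ξ = G ξ fun ζ => F ζ := fun ξ => WellFounded.fix_eq _ _ _
  exact ⟨F, fun ξ => by rw [hF ξ]; exact hG _ _⟩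

theorem exists_cofinal_map (o : Ordinal.{u}) :
    ∃ a : o.cof.ord.ToType → o.ToType, ∀ b, ∃ ξ, b ≤ a ξ := by
  obtain ⟨S, hS, hcard⟩ := Order.exists_cof_eq (α := o.ToType)
  rw [Ordinal.cof_toType, ← mk_ord_toType o.cof] at hcard
  obtain ⟨e⟩ := Cardinal.eq.1 hcard
  refine ⟨fun ξ => e.symm ξ, fun b => ?_⟩
  obtain ⟨c, hc, hbc⟩ := hS b
  exact ⟨e ⟨c, hc⟩, by simpa only [Equiv.symm_apply_apply] using hbc⟩

theorem exists_eventually_le_of_cof_lt {L X : Type u} [LinearOrder L] [WellFoundedLT L]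
    [Nonempty X] {U : L → SigmaUltrafilter X} {h : (L → X) → Ordinal.{u}} (hh : Finitary h)
    {o : Ordinal.{u}} (ho : ∀ x, h x < o) {c : Cardinal.{u}}
    (hc : ∀ i, CardinalInterFilter ((U i).1 : Filter X) c) (hcof : o.cof < c) :
    ∃ θ < o, ∀ᶠ x in iterFilter U, h x ≤ θ := by
  have := cardinalInterFilter_iterFilter hc
  obtain ⟨a, ha⟩ := exists_cofinal_map o
  by_contra hcon
  have hgt : ∀ᶠ x in iterFilter U, ∀ ξ, ¬ h x ≤ rk (a ξ) :=
    (eventually_cardinal_forall (by rwa [mk_ord_toType])).2 fun ξ =>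
      (hh.comp (· ≤ rk (a ξ))).eventually_not.2 fun hle =>
        hcon ⟨_, rk_lt _, hle⟩
  obtain ⟨x, hx⟩ := hgt.exists
  obtain ⟨ξ, hξ⟩ := ha (elt (h x) (ho x))
  exact hx ξ (by simpa only [rk_elt] using rk_strictMono.monotone hξ)

theorem power_lt_of_isStrongPrelimit {a b κ : Cardinal.{u}} (hκ : IsStrongPrelimit κ)
    (hκ₀ : ℵ₀ < κ) (ha : a < κ) (hb : b < κ) : a ^ b < κ := by
  have hm : ℵ₀ ≤ max (max a b) ℵ₀ := le_max_right _ _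
  calc a ^ b ≤ max (max a b) ℵ₀ ^ b :=
        power_le_power_right ((le_max_left _ _).trans (le_max_left _ _))
    _ ≤ max (max a b) ℵ₀ ^ max (max a b) ℵ₀ :=
        power_le_power_left (aleph0_pos.trans_le hm).ne'
          ((le_max_right _ _).trans (le_max_left _ _))
    _ = 2 ^ max (max a b) ℵ₀ := power_self_eq hm
    _ < κ := hκ (max_lt (max_lt ha hb) hκ₀)

/-- The functions have the same values before `ξ` up to truncation at `c`. Without truncation
there would be too many functions to be coded by iteration lengths below `κ`. -/
def TruncEq {Λ : Type u} [LT Λ] (c : Ordinal.{u}) (ξ : Λ) (f g : Λ → Ordinal.{u}) : Prop :=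
  ∀ ζ < ξ, min (f ζ) c = min (g ζ) c

section Coding

variable {κ : Cardinal.{u}} [Nonempty κ.ord.ToType] {Λ : Type u} [LT Λ]

/-- The iteration lengths `o f` code the part of `f` before `ξ`: it can be recovered, up to
truncation, from the part below `T` of the image of `y` under the iteration of `M` of that length.
-/
structure IsCoding (M : MeasureBelow κ) (y : ZFSet.{u}) (ξ : Λ)
    (o : (Λ → Ordinal.{u}) → Cardinal.{u}) (T : Cardinal.{u}) : Prop where
  lt : T < κ
  card_lt : M.card < T
  inaccessible : IsInaccessible T
  card_le : ∀ f, M.card ≤ o f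
  lt_top : ∀ f, o f < T
  congr : ∀ f g, TruncEq M.card.ord ξ f g → o f = o g
  truncEq : ∀ f g, AgreeBelow T.ord (M.block (o f) y) (M.block (o g) y) →
    TruncEq M.card.ord ξ f g

theorem exists_isCoding {A : Type*} {N : A → MeasureBelow κ} (hN : IsCofinalFamily N)
    {M : MeasureBelow κ} {y : ZFSet.{u}} (hy : M.Moves y) {ξ : Λ} (hξ : #{ζ // ζ < ξ} < κ) :
    ∃ o T, IsCoding M y ξ o T := by
  let trunc : (Λ → Ordinal.{u}) → {ζ // ζ < ξ} → (Order.succ M.card.ord).ToType := fun f ζ =>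
    elt (min (f ζ) M.card.ord) (Order.lt_succ_of_le (min_le_right _ _))
  have htrunc : ∀ f g, trunc f = trunc g ↔ TruncEq M.card.ord ξ f g := fun f g =>
    ⟨fun h ζ hζ => by simpa only [trunc, rk_elt] using congrArg rk (congrFun h ⟨ζ, hζ⟩),
      fun h => funext fun ζ => rk_injective (by simpa only [trunc, rk_elt] using h ζ ζ.2)⟩
  have hcodes : #({ζ // ζ < ξ} → (Order.succ M.card.ord).ToType) < κ := by
    rw [← power_def]
    refine power_lt_of_isStrongPrelimit hN.isStrongPrelimit hN.aleph0_lt ?_ hξ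
    rw [mk_toType, ← lt_ord]
    exact (isSuccLimit_ord hN.aleph0_lt.le).succ_lt (ord_lt_ord.2 M.lt)
  obtain ⟨o, T, hT, hMT, hTi, ho, hinj⟩ := M.exists_lengths hN hy hcodes
  exact ⟨fun f => o (trunc f), T, hT, hMT, hTi, fun f => (ho _).1, fun f => (ho _).2,
    fun f g h => congrArg o ((htrunc f g).2 h), fun f g h => (htrunc f g).1 (hinj _ _ h)⟩

end Coding

/-- The index type of sequences of length `cof κ`. -/
abbrev CofType (κ : Cardinal.{u}) : Type u := κ.ord.cof.ord.ToType

theorem mk_Iio_cofType_lt {κ : Cardinal.{u}} (ξ : CofType κ) : #(Iio ξ) < κ :=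
  (mk_Iio_ord_lt ξ).trans_le (Ordinal.cof_ord_le κ)

/-- A cofinal sequence of measures below `κ` together with codings by iterations of these measures.
The bound `ρ` makes the measures sufficiently complete for fixing small parameters. -/
structure Tower (κ : Cardinal.{u}) [Nonempty κ.ord.ToType] (y : ZFSet.{u}) (ρ : Cardinal.{u}) where
  measure : CofType κ → MeasureBelow κ
  len : CofType κ → (CofType κ → Ordinal.{u}) → Cardinal.{u}
  top : CofType κ → Cardinal.{u}
  isCoding : ∀ ξ, IsCoding (measure ξ) y ξ (len ξ) (top ξ)
  lt_card : ∀ ξ, ρ < (measure ξ).card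
  cof_lt_card : κ.ord.cof < κ → ∀ ξ, κ.ord.cof < (measure ξ).card
  mk_Iio_lt : ∀ ξ, #(Iio ξ) < (measure ξ).card
  exists_bound : ∀ ξ, ∃ t < (measure ξ).card, ∀ ζ < ξ, top ζ ≤ t
  isCofinalFamily : IsCofinalFamily measure

theorem exists_tower {κ : Cardinal.{u}} [Nonempty κ.ord.ToType] {A : Type*}
    {N : A → MeasureBelow κ} (hN : IsCofinalFamily N) {y : ZFSet.{u}} (hy : ∀ i, (N i).Moves y)
    {ρ : Cardinal.{u}} (hρ : ρ < κ) : Nonempty (Tower κ y ρ) := by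
  choose o T hoT using fun i ξ => exists_isCoding hN (hy i) (mk_Iio_cofType_lt (κ := κ) ξ)
  obtain ⟨a, ha⟩ := exists_cofinal_map κ.ord
  obtain ⟨i, hi⟩ := exists_forall_of_forall_exists_lt (Λ := CofType κ) (A := A)
    (P := fun ξ g i => (κ.ord.cof < κ → κ.ord.cof < (N i).card) ∧ ρ < (N i).card ∧
      #(Iio ξ) < (N i).card ∧ (rk (a ξ)).card < (N i).card ∧
      (⨆ ζ : Iio ξ, T (g ζ) ζ) < (N i).card) fun ξ g => by
    have hsup : (⨆ ζ : Iio ξ, T (g ζ) ζ) < κ :=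
      iSup_lt_of_lt_cof_ord (mk_Iio_ord_lt ξ) fun ζ => (hoT _ _).lt
    obtain ⟨ν, hν, hcof⟩ : ∃ ν < κ, κ.ord.cof < κ → κ.ord.cof ≤ ν := by
      by_cases h : κ.ord.cof < κ
      exacts [⟨_, h, fun _ => le_rfl⟩, ⟨ρ, hρ, fun h' => absurd h' h⟩]
    obtain ⟨i, hi⟩ := hN (max (max (max ν ρ) #(Iio ξ))
      (max (rk (a ξ)).card (⨆ ζ : Iio ξ, T (g ζ) ζ)))
      (max_lt (max_lt (max_lt hν hρ) (mk_Iio_cofType_lt ξ)) (max_lt (lt_ord.1 (rk_lt _)) hsup))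
    simp only [max_lt_iff] at hi
    exact ⟨i, fun h => (hcof h).trans_lt hi.1.1.1, hi.1.1.2, hi.1.2, hi.2.1, hi.2.2⟩
  exact ⟨{
    measure := fun ξ => N (i ξ)
    len := fun ξ => o (i ξ) ξ
    top := fun ξ => T (i ξ) ξ
    isCoding := fun ξ => hoT _ _
    lt_card := fun ξ => (hi ξ).2.1
    cof_lt_card := fun h ξ => (hi ξ).1 h
    mk_Iio_lt := fun ξ => (hi ξ).2.2.1
    exists_bound := fun ξ => ⟨_, (hi ξ).2.2.2.2, fun ζ hζ =>
      le_ciSup (f := fun ζ : Iio ξ => T (i ζ) ζ) bddAbove_of_small ⟨ζ, hζ⟩⟩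
    isCofinalFamily := fun ν hν => by
      obtain ⟨ξ, hξ⟩ := ha (elt ν.ord (ord_lt_ord.2 hν))
      refine ⟨ξ, lt_of_le_of_lt ?_ (hi ξ).2.2.2.1⟩
      rw [← card_ord ν, ← rk_elt (ord_lt_ord.2 hν)]
      exact Ordinal.card_le_card (rk_strictMono.monotone hξ) }⟩

namespace Tower

variable {κ : Cardinal.{u}} [Nonempty κ.ord.ToType] {y : ZFSet.{u}} {ρ : Cardinal.{u}}
  (𝒯 : Tower κ y ρ)

theorem top_lt_card {ζ ξ : CofType κ} (h : ζ < ξ) : 𝒯.top ζ < (𝒯.measure ξ).card := by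
  obtain ⟨t, ht, hζ⟩ := 𝒯.exists_bound ξ
  exact (hζ ζ h).trans_lt ht

theorem strictMono_card : StrictMono fun ξ => (𝒯.measure ξ).card := fun ζ _ h =>
  (𝒯.isCoding ζ).card_lt.trans (𝒯.top_lt_card h)

theorem strictMono_top : StrictMono 𝒯.top := fun _ ξ h =>
  (𝒯.top_lt_card h).trans (𝒯.isCoding ξ).card_lt

/-- The number of uses of each measure in the iteration that codes a function. -/
noncomputable def width (f : CofType κ → Ordinal.{u}) (ξ : CofType κ) : Ordinal.{u} :=
  blockLength (𝒯.len ξ f)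

/-- The image of `y` under the iteration that codes a function. -/
noncomputable def image (f : CofType κ → Ordinal.{u}) : ZFSet.{u} :=
  emb (ults 𝒯.measure (𝒯.width f)) y

/-- The iteration that codes a function, restricted to the measures with positions in `S`. -/
noncomputable def partialEmb (S : Set (CofType κ)) (f : CofType κ → Ordinal.{u}) :
    ZFSet.{u} → ZFSet.{u} :=
  emb (ults 𝒯.measure (S.indicator (𝒯.width f)))

variable {f g : CofType κ → Ordinal.{u}} {ξ : CofType κ}

theorem width_le_top (f : CofType κ → Ordinal.{u}) (ξ : CofType κ) :
    𝒯.width f ξ ≤ (𝒯.top ξ).ord := by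
  have hlt := mk_blockLength_toType_lt (𝒯.isCoding ξ).inaccessible ((𝒯.isCoding ξ).lt_top f)
  rw [mk_toType] at hlt
  exact (lt_ord.2 hlt).le

theorem partialEmb_Iio_congr (h : ∀ ζ < ξ, 𝒯.len ζ f = 𝒯.len ζ g) :
    𝒯.partialEmb (Iio ξ) f = 𝒯.partialEmb (Iio ξ) g :=
  congrArg (fun w => emb (ults 𝒯.measure w)) <|
    indicator_congr fun ζ hζ => congrArg blockLength (h ζ hζ)

theorem mk_steps_Iio_lt (f : CofType κ → Ordinal.{u}) (ξ : CofType κ) :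
    #(Steps ((Iio ξ).indicator (𝒯.width f))) < (𝒯.measure ξ).card := by
  obtain ⟨t, ht, htop⟩ := 𝒯.exists_bound ξ
  exact (Steps.mk_indicator_le fun ζ hζ =>
      (𝒯.width_le_top f ζ).trans (ord_le_ord.2 (htop ζ hζ))).trans_lt
    (mul_lt_of_lt (𝒯.measure ξ).inaccessible.aleph0_lt.le (𝒯.mk_Iio_lt ξ) ht)

theorem exists_concentrate_Iio (f : CofType κ → Ordinal.{u}) (ξ : CofType κ) :
    ∃ Y : Set κ.ord.ToType, #Y < (𝒯.measure ξ).card ∧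
      ∀ p, Y ∈ (ults 𝒯.measure ((Iio ξ).indicator (𝒯.width f)) p).1 := by
  obtain ⟨t, ht, htop⟩ := 𝒯.exists_bound ξ
  exact ⟨{x | rk x < t.ord}, (mk_setOf_rk_lt_le t).trans_lt ht, fun p =>
    (𝒯.measure p.pos).setOf_rk_lt_mem
      ((𝒯.isCoding p.pos).card_lt.le.trans (htop _ p.pos_mem_of_indicator))⟩

theorem partialEmb_Iio_block (f : CofType κ → Ordinal.{u}) (ξ : CofType κ) :
    𝒯.partialEmb (Iio ξ) f ((𝒯.measure ξ).block (𝒯.len ξ f) y) = 𝒯.partialEmb (Iic ξ) f y := by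
  obtain ⟨Y, hYξ, hY⟩ := 𝒯.exists_concentrate_Iio f ξ
  have hlen := (𝒯.isCoding ξ).card_le f
  exact emb_emb_of_embOrd_eq_self (U := ults 𝒯.measure ((Iic ξ).indicator (𝒯.width f)))
    (V := (𝒯.measure ξ).ult) (Steps.isConcat_indicator (𝒯.width f) ξ)
    (embOrd_ord_succ_two_power ((𝒯.measure ξ).inaccessible.aleph0_lt.le.trans hlen)
      ((𝒯.mk_steps_Iio_lt f ξ).le.trans (hlen.trans (cantor _).le)) hY (hYξ.le.trans hlen))
    (fun _ => rfl) y

theorem isEndExtension_Iio (f : CofType κ → Ordinal.{u}) (ξ : CofType κ) :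
    IsEndExtension (𝒯.measure ξ).card (ults 𝒯.measure ((Iio ξ).indicator (𝒯.width f)))
      (ults 𝒯.measure (𝒯.width f)) (Steps.incl (indicator_le_self' fun _ _ => zero_le)) :=
  isEndExtension_indicator (isLowerSet_Iio ξ) fun _ hζ =>
    𝒯.strictMono_card.monotone (le_of_not_gt hζ)

theorem agreeBelow_image_Iio (f : CofType κ → Ordinal.{u}) (ξ : CofType κ) :
    AgreeBelow (𝒯.measure ξ).card.ord (𝒯.image f) (𝒯.partialEmb (Iio ξ) f y) := fun _ hθ =>
  (𝒯.isEndExtension_Iio f ξ).toZFSet_mem_emb_iff y hθ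

theorem agreeBelow_image_Iic (f : CofType κ → Ordinal.{u}) (ξ : CofType κ) :
    AgreeBelow (𝒯.top ξ).ord (𝒯.image f) (𝒯.partialEmb (Iic ξ) f y) := fun _ hθ =>
  (isEndExtension_indicator (isLowerSet_Iic ξ) fun _ hζ =>
    (𝒯.top_lt_card (not_le.1 hζ)).le).toZFSet_mem_emb_iff y hθ

theorem agreeBelow_image_of_eq (h : ∀ ζ < ξ, f ζ = g ζ) :
    AgreeBelow (𝒯.measure ξ).card.ord (𝒯.image f) (𝒯.image g) := by
  have hlen : ∀ ζ < ξ, 𝒯.len ζ f = 𝒯.len ζ g := fun ζ hζ =>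
    (𝒯.isCoding ζ).congr f g fun η hη => by rw [h η (hη.trans hζ)]
  have hf := 𝒯.agreeBelow_image_Iio f ξ
  rw [𝒯.partialEmb_Iio_congr hlen] at hf
  exact hf.trans (𝒯.agreeBelow_image_Iio g ξ).symm

theorem agreeBelow_partialEmb_Iio_iff {x z : ZFSet.{u}} :
    AgreeBelow (𝒯.top ξ).ord (𝒯.partialEmb (Iio ξ) f x) (𝒯.partialEmb (Iio ξ) f z) ↔
      AgreeBelow (𝒯.top ξ).ord x z := by
  obtain ⟨Y, hYξ, hY⟩ := 𝒯.exists_concentrate_Iio f ξ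
  have hcard := (𝒯.isCoding ξ).card_lt
  exact agreeBelow_emb_iff_of_embOrd_eq_self (embOrd_ord_of_isInaccessible
    (𝒯.isCoding ξ).inaccessible ((𝒯.mk_steps_Iio_lt f ξ).trans hcard) hY (hYξ.trans hcard))

theorem truncEq_of_agreeBelow_image
    (h : AgreeBelow (𝒯.top ξ).ord (𝒯.image f) (𝒯.image g)) {ζ : CofType κ} (hζ : ζ ≤ ξ) :
    TruncEq (𝒯.measure ζ).card.ord ζ f g := by
  induction ζ using WellFoundedLT.induction with
  | _ ζ ih =>
    have hpartial : 𝒯.partialEmb (Iio ζ) f = 𝒯.partialEmb (Iio ζ) g :=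
      𝒯.partialEmb_Iio_congr fun η hη =>
        (𝒯.isCoding η).congr f g (ih η hη (hη.le.trans hζ))
    refine (𝒯.isCoding ζ).truncEq f g ((𝒯.agreeBelow_partialEmb_Iio_iff (f := f)).1 ?_)
    rw [partialEmb_Iio_block, hpartial, partialEmb_Iio_block]
    exact (𝒯.agreeBelow_image_Iic f ζ).symm.trans
      ((h.mono (ord_le_ord.2 (𝒯.strictMono_top.monotone hζ))).trans (𝒯.agreeBelow_image_Iic g ζ))

theorem exists_eq_of_agreeBelow_image (hf : ∀ ζ, f ζ < κ.ord) (ξ : CofType κ) :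
    ∃ ξ', ∀ g, AgreeBelow (𝒯.top ξ').ord (𝒯.image f) (𝒯.image g) → ∀ ζ < ξ, f ζ = g ζ := by
  have hsup : (⨆ ζ : Iio ξ, f ζ) < κ.ord :=
    Ordinal.iSup_lt_of_lt_cof (mk_Iio_ord_lt ξ) fun ζ => hf ζ
  obtain ⟨ξ₁, hξ₁⟩ := 𝒯.isCofinalFamily _ (lt_ord.1 hsup)
  refine ⟨max ξ ξ₁, fun g h ζ hζ => ?_⟩
  have htrunc := 𝒯.truncEq_of_agreeBelow_image h le_rfl ζ (hζ.trans_le (le_max_left _ _))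
  have hlt : f ζ < (𝒯.measure (max ξ ξ₁)).card.ord :=
    (Ordinal.le_iSup (fun ζ : Iio ξ => f ζ) ⟨ζ, hζ⟩).trans_lt ((lt_ord.2 hξ₁).trans_le
      (ord_le_ord.2 (𝒯.strictMono_card.monotone (le_max_right _ _))))
  rw [min_eq_left hlt.le] at htrunc
  rcases min_choice (g ζ) (𝒯.measure (max ξ ξ₁)).card.ord with hmin | hmin
  · rw [htrunc, hmin]
  · exact absurd (htrunc.trans hmin) hlt.ne

theorem embOrd_lt (f : CofType κ → Ordinal.{u}) {θ : Ordinal.{u}} (hθ : θ < κ.ord) :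
    embOrd (ults 𝒯.measure (𝒯.width f)) θ < κ.ord := by
  obtain ⟨ξ, hξ⟩ := 𝒯.isCofinalFamily _ (lt_ord.1 hθ)
  obtain ⟨Y, hYξ, hY⟩ := 𝒯.exists_concentrate_Iio f ξ
  have heq : embOrd (ults 𝒯.measure (𝒯.width f)) θ = _ :=
    (𝒯.isEndExtension_Iio f ξ).collapseOrd_comp_right (.const θ) fun _ => lt_ord.2 hξ
  rw [heq]
  exact embOrd_lt_ord_of_isStrongPrelimit 𝒯.isCofinalFamily.isStrongPrelimit
    𝒯.isCofinalFamily.aleph0_lt ((𝒯.mk_steps_Iio_lt f ξ).trans (𝒯.measure ξ).lt) hY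
    (hYξ.trans (𝒯.measure ξ).lt) hθ

theorem exists_eventually_le {w : CofType κ → Ordinal.{u}}
    {h : (Steps w → κ.ord.ToType) → Ordinal.{u}} (hh : Finitary h) (hκ : ∀ x, h x < κ.ord) :
    ∃ θ < κ.ord, ∀ᶠ x in iterFilter (ults 𝒯.measure w), h x ≤ θ := by
  rcases (Ordinal.cof_ord_le κ).lt_or_eq with hcof | hcof
  · exact exists_eventually_le_of_cof_lt hh hκ (fun p =>
      (𝒯.measure p.pos).complete_of_le (Order.succ_le_of_lt (𝒯.cof_lt_card hcof _)))
      (Order.lt_succ _)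
  · obtain ⟨s, hs⟩ := hh
    have hκ₀ := 𝒯.isCofinalFamily.aleph0_lt
    let t : Cardinal.{u} := s.sup fun p => (𝒯.measure p.pos).card
    have ht : t < κ := (Finset.sup_lt_iff (aleph0_pos.trans hκ₀)).2 fun p _ => (𝒯.measure p.pos).lt
    exact exists_eventually_le_of_concentrate hs (Y := {x | rk x < t.ord})
      (fun p hp => (𝒯.measure p.pos).setOf_rk_lt_mem
        (Finset.le_sup (f := fun p : Steps w => (𝒯.measure p.pos).card) hp))
      (hcof.symm ▸ max_lt ((mk_setOf_rk_lt_le t).trans_lt ht) hκ₀) hκ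

theorem embOrd_ord (f : CofType κ → Ordinal.{u}) :
    embOrd (ults 𝒯.measure (𝒯.width f)) κ.ord = κ.ord :=
  embOrd_eq_self_of_bounded (fun _ hg hgκ => 𝒯.exists_eventually_le hg hgκ)
    fun _ hθ => 𝒯.embOrd_lt f hθ

end Tower

/-! ### Perfect embeddings -/

theorem isPerfectEmbedding_of_agreeBelow {μ κ ν : Ordinal.{u}} (hμ : Order.IsSuccLimit μ)
    {ι : PerfectSubset.FunSpace μ κ → PerfectSubset.PowSpace ν}
    (hcont : ∀ f, ∀ η < ν, ∃ ξ < μ, ∀ g, (∀ i : Iio μ, i.1 < ξ → f i = g i) →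
      AgreeBelow η (ι f).1 (ι g).1)
    (hopen : ∀ f, ∀ ξ < μ, ∃ η < ν, ∀ g, AgreeBelow η (ι f).1 (ι g).1 →
      ∀ i : Iio μ, i.1 < ξ → f i = g i) :
    PerfectSubset.IsPerfectEmbedding ι := by
  simp only [← inter_toZFSet_eq_iff] at hcont hopen
  refine ⟨⟨le_antisymm ?_ ?_⟩, fun f g hfg => funext fun i => ?_⟩
  · refine continuous_iff_le_induced.1 (continuous_generateFrom_iff.2 ?_)
    rintro _ ⟨η, hη, a, -, rfl⟩
    refine isOpen_iff_forall_mem_open.2 fun f hf => ?_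
    obtain ⟨ξ, hξ, h⟩ := hcont f η hη
    refine ⟨PerfectSubset.FunSpace.cone hξ fun i => f ⟨i.1, lt_trans i.2 hξ⟩, fun g hg => ?_,
      TopologicalSpace.isOpen_generateFrom_of_mem ⟨ξ, hξ, _, rfl⟩, fun i => rfl⟩
    exact (h g fun i hi => (hg ⟨i.1, hi⟩).symm).symm.trans hf
  · refine le_generateFrom ?_
    rintro _ ⟨ξ, hξ, s, rfl⟩
    choose η hη h using fun f => hopen f ξ hξ
    refine isOpen_induced_iff.2 ⟨⋃ f ∈ PerfectSubset.FunSpace.cone hξ s,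
      {z | z.1 ∩ (η f).toZFSet = (ι f).1 ∩ (η f).toZFSet}, isOpen_biUnion fun f _ =>
        TopologicalSpace.isOpen_generateFrom_of_mem
          ⟨η f, hη f, _, fun w hw => (ZFSet.mem_inter.1 hw).2, rfl⟩, ?_⟩
    ext g
    simp only [mem_preimage, mem_iUnion]
    constructor
    · rintro ⟨f, hf, hg⟩ i
      rw [← hf i]
      exact (h f g (Eq.symm hg) ⟨i.1, lt_trans i.2 hξ⟩ i.2).symm
    · exact fun hg => ⟨g, hg, rfl⟩
  · obtain ⟨η, -, h⟩ := hopen f (i.1 + 1) (hμ.add_one_lt i.2)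
    exact h g (by rw [hfg]) i (Order.lt_add_one_iff.2 le_rfl)

theorem Tower.isPerfectEmbedding {κ : Cardinal.{u}} [Nonempty κ.ord.ToType] {y : ZFSet.{u}}
    {ρ : Cardinal.{u}} (𝒯 : Tower κ y ρ)
    {ι : PerfectSubset.FunSpace κ.ord.cof.ord κ.ord → PerfectSubset.PowSpace κ.ord}
    (hι : ∀ f, (ι f).1 = 𝒯.image fun ξ => (f ⟨rk ξ, rk_lt ξ⟩).1) :
    PerfectSubset.IsPerfectEmbedding ι := by
  have hlim : Order.IsSuccLimit κ.ord.cof.ord :=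
    isSuccLimit_ord (Ordinal.aleph0_le_cof_iff.2 (Ordinal.one_lt_cof_iff.2
      (isSuccLimit_ord 𝒯.isCofinalFamily.aleph0_lt.le)))
  refine isPerfectEmbedding_of_agreeBelow hlim (fun f η hη => ?_) fun f ξ hξ => ?_
  · obtain ⟨ξ, hξ⟩ := 𝒯.isCofinalFamily _ (lt_ord.1 hη)
    refine ⟨rk ξ, rk_lt ξ, fun g hg => ?_⟩
    rw [hι, hι]
    refine (𝒯.agreeBelow_image_of_eq fun ζ hζ => ?_).mono (lt_ord.2 hξ).le
    rw [hg ⟨rk ζ, rk_lt ζ⟩ (rk_lt_rk.2 hζ)]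
  · obtain ⟨ξ', h⟩ := 𝒯.exists_eq_of_agreeBelow_image (f := fun ξ => (f ⟨rk ξ, rk_lt ξ⟩).1)
      (fun ζ => (f ⟨rk ζ, rk_lt ζ⟩).2) (elt ξ hξ)
    refine ⟨_, ord_lt_ord.2 (𝒯.isCoding ξ').lt, fun g hg i hiξ => Subtype.ext ?_⟩
    rw [hι, hι] at hg
    obtain ⟨i, hi : i < κ.ord.cof.ord⟩ := i
    have hfg := h _ hg (elt i hi) (by rwa [← rk_lt_rk, rk_elt, rk_elt])
    simpa only [rk_elt] using hfg

/-! ### Definable sets -/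

theorem isSmallTransitive_mk_transClosure_le (ρ : Cardinal.{u}) :
    IsSmallTransitive (Order.succ ρ)
      {x : ZFSet.{u} | #(PerfectSubset.transClosure x) ≤ lift.{u + 1} ρ} where
  mem_of_mem t ht s hs := by
    have hsub : PerfectSubset.transClosure s ⊆ PerfectSubset.transClosure t :=
      fun r hr => Relation.TransGen.tail hr hs
    exact (mk_le_mk_of_subset hsub).trans ht
  smallSet t ht := by
    have hsub : (t : Set ZFSet.{u}) ⊆ PerfectSubset.transClosure t :=
      fun s hs => Relation.TransGen.single hs
    have hcard : #(Shrink t) ≤ ρ := by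
      change t.card ≤ ρ
      rw [← Cardinal.lift_le.{u + 1}, ← ZFSet.cardinalMk_coe_sort]
      exact (mk_le_mk_of_subset hsub).trans ht
    exact ⟨Shrink t, fun a => (equivShrink t).symm a, Order.lt_succ_of_le hcard, fun s hs =>
      ⟨equivShrink t ⟨s, hs⟩, by simp only [Equiv.symm_apply_apply]⟩⟩

theorem exists_forall_emb_mem {κ : Cardinal.{u}} (hκ : κ ≠ 0) {D : ZFSet.{u}}
    (hD : PerfectSubset.Sigma1DefinableWith (PerfectSubset.H κ ∪ {κ.ord.toZFSet}) D) :
    ∃ ρ < κ, ∀ ⦃L X : Type u⦄ [LinearOrder L] [WellFoundedLT L] [Nonempty X]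
      (U : L → SigmaUltrafilter X),
      (∀ i, CardinalInterFilter ((U i).1 : Filter X) (Order.succ ρ)) → embOrd U κ.ord = κ.ord →
        ∀ y ∈ D, emb U y ∈ D := by
  obtain ⟨n, φ, p, hφ, hp, hDφ⟩ := hD
  have hbound : ∀ i, ∃ ρ < κ, p i = κ.ord.toZFSet ∨
      #(PerfectSubset.transClosure (p i)) ≤ lift.{u + 1} ρ := fun i => by
    rcases hp i with h | h
    · obtain ⟨ρ, hρκ, hρ⟩ := lt_lift_iff.1 h
      exact ⟨ρ, hρκ, .inr hρ.ge⟩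
    · exact ⟨0, pos_iff_ne_zero.2 hκ, .inl h⟩
  choose r hrκ hr using hbound
  refine ⟨Finset.univ.sup r, (Finset.sup_lt_iff (pos_iff_ne_zero.2 hκ)).2 fun i _ => hrκ i,
    fun L X _ _ _ U hU hUκ y hy => (hDφ _).2 ?_⟩
  have hp_eq : ∀ i, emb U (p i) = p i := fun i => by
    rcases hr i with h | h
    · rw [h, emb_toZFSet, hUκ]
    · exact emb_eq_self_of_isSmallTransitive hU (isSmallTransitive_mk_transClosure_le _)
        (h.trans (Cardinal.lift_le.2 (Finset.le_sup (Finset.mem_univ i))))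
  have hcons : (fun a => emb U ((Fin.cons y p : Fin (n + 1) → ZFSet.{u}) a)) =
      Fin.cons (emb U y) p := funext <| Fin.cases rfl hp_eq
  have hreal := realize_emb_of_isSigma1 (U := U) hφ ((hDφ y).1 hy)
  rw [hcons] at hreal
  rw [FirstOrder.Language.Formula.Realize]
  convert hreal

end IteratedUltrapower

open IteratedUltrapower in
theorem theorem1p1 (κ : Cardinal.{u}) (hκ : PerfectSubset.IsLimitOfMeasurables κ)
    (D : ZFSet.{u}) (hD : D ⊆ ZFSet.powerset κ.ord.toZFSet)
    (hdef : PerfectSubset.Sigma1DefinableWith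
      (PerfectSubset.H κ ∪ {κ.ord.toZFSet}) D)
    (hcard : κ < D.card) :
    ∃ ι : PerfectSubset.FunSpace κ.ord.cof.ord κ.ord → PerfectSubset.PowSpace κ.ord,
      PerfectSubset.IsPerfectEmbedding ι ∧ ∀ c, (ι c).1 ∈ D := by
  have : Nonempty κ.ord.ToType := mk_ne_zero_iff.1 (by rw [mk_ord_toType]; exact hκ.1)
  obtain ⟨M, hM⟩ := exists_isCofinalFamily hκ
  obtain ⟨y, hyD, hy⟩ := exists_forall_moves hM hD hcard
  obtain ⟨ρ, hρ, hemb⟩ := exists_forall_emb_mem hκ.1 hdef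
  obtain ⟨𝒯⟩ := exists_tower hM hy hρ
  have hmem : ∀ f, 𝒯.image f ∈ D := fun f => by
    refine hemb _ (fun p : Steps (𝒯.width f) => ?_) (𝒯.embOrd_ord f) y hyD
    exact (𝒯.measure p.pos).complete_of_le (Order.succ_le_of_lt (𝒯.lt_card _))
  exact ⟨fun f => ⟨𝒯.image fun ξ => (f ⟨rk ξ, rk_lt ξ⟩).1, ZFSet.mem_powerset.1 (hD (hmem _))⟩,
    𝒯.isPerfectEmbedding fun _ => rfl, fun _ => hmem _⟩
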